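/- Let $\Sigma=(A,G,\alpha,\sigma)$ be a twisted unital discrete $C^*$-dynamical system: $A$ is a unital $C^*$-algebra, $G$ a discrete group with identity $e$, and $\alpha:G\to\mathrm{Aut}(A)$, $\sigma:G\times G\to\mathcal U(A)$ are maps such that, for all $g,h,k\in G$, $$\alpha_g\circ\alpha_h=\mathrm{Ad}(\sigma(g,h))\circ\alpha_{gh},\qquad \sigma(g,h)\,\sigma(gh,k)=\alpha_g(\sigma(h,k))\,\sigma(g,hk),\qquad \sigma(g,e)=\sigma(e,g)=1 .$$ A covariant homomorphism of $\Sigma$ into a unital $C^*$-algebra $C$ is a pair $(\pi,u)$ of a unital $*$-homomorphism $\pi:A\to C$ and a map $u:G\to\mathcal U(C)$ with $u(g)u(h)=\pi(\sigma(g,h))u(gh)$ and $\pi(\alpha_g(a))=u(g)\pi(a)u(g)^*$. Let $C_c(\Sigma)$ be the unital $*$-algebra of finitely supported functions $f:G\to A$ with $$(f_1*f_2)(h)=\sum_{g\in G}f_1(g)\,\alpha_g(f_2(g^{-1}h))\,\sigma(g,g^{-1}h),\qquad f^*(h)=\sigma(h,h^{-1})^*\alpha_h(f(h^{-1}))^*,$$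 and put $(\pi\times u)(f)=\sum_{g}\pi(f(g))u(g)$. The full crossed product $C^*(\Sigma)$ is the completion of $C_c(\Sigma)$ in the norm $\|f\|_*=\sup_{(\pi,u)}\|(\pi\times u)(f)\|$; each $\pi\times u$ extends to a unital $*$-homomorphism of $C^*(\Sigma)$, and every unital $*$-homomorphism of $C^*(\Sigma)$ into a unital $C^*$-algebra is of this form. Let $A^G$ be the right Hilbert $A$-module of all $\xi:G\to A$ such that $\sum_g\xi(g)^*\xi(g)$ is norm-convergent, with $\langle\xi,\eta\rangle=\sum_g\xi(g)^*\eta(g)$ and $(\xi\cdot a)(g)=\xi(g)a$, let $\mathcal L(A^G)$ be the $C^*$-algebra of its adjointable operators, and let $\Lambda=\tilde\ell\times\tilde\lambda:C^*(\Sigma)\to\mathcal L(A^G)$ where $$(\tilde\ell(a)\xi)(h)=\alpha_h^{-1}(a)\xi(h),\qquad (\tilde\lambda(g)\xi)(h)=\alpha_h^{-1}(\sigma(g,g^{-1}h))\,\xi(g^{-1}h).$$ Let $C^*_r(\Sigma)$ be the $C^*$-subalgebra of $\mathcal L(A^G)$ generated by $\Lambda(C_c(\Sigma))$. Let $A^\Sigma$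 be the right Hilbert $A$-module of all $\xi:G\to A$ such that $\sum_g\alpha_g^{-1}(\xi(g)^*\xi(g))$ is norm-convergent, with $\langle\xi,\eta\rangle_\alpha=\sum_g\alpha_g^{-1}(\xi(g)^*\eta(g))$ and $(\xi\times a)(g)=\xi(g)\alpha_g(a)$, and let $\Lambda_\Sigma=\ell_\Sigma\times\lambda_\Sigma:C^*(\Sigma)\to\mathcal L(A^\Sigma)$ where, with the unitary $J:A^G\to A^\Sigma$, $(J\xi)(g)=\alpha_g(\xi(g))$, we put $\ell_\Sigma(a)=J\tilde\ell(a)J^*$ and $\lambda_\Sigma(g)=J\tilde\lambda(g)J^*$; that is, $(\ell_\Sigma(a)\xi)(h)=a\,\xi(h)$ and $(\lambda_\Sigma(g)\xi)(h)=\alpha_g(\xi(g^{-1}h))\,\sigma(g,g^{-1}h)$. Two unital $*$-homomorphisms defined on the same $C^*$-algebra are called weakly equivalent if they have the same kernel. **Proposition.** Let $\phi=\pi\times u$ be a unital $*$-homomorphism of $C^*(\Sigma)$ into a unital $C^*$-algebra $C$, and set $B=\phi(C^*(\Sigma))$. The following conditions are equivalent: 1. $\phi$ is weakly equivalent to $\Lambda_\Sigma$;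 2. $\phi$ is weakly equivalent to $\Lambda$; 3. $\pi$ is injective and there is a faithful conditional expectation $F$ from $B$ onto $\pi(A)$ such that $F(u(g))=0$ for all $g\in G$ with $g\neq e$. In particular, if (3) holds, then $B$ is $*$-isomorphic to $C^*_r(\Sigma)$. Here a conditional expectation from $B$ onto $\pi(A)$ is a linear, positive, contractive map $F:B\to\pi(A)$ with $F(d)=d$, $F(dx)=dF(x)$ and $F(xd)=F(x)d$ for $d\in\pi(A)$, $x\in B$; it is faithful if $F(x^*x)=0$ implies $x=0$. -/

import Mathlib

noncomputable section

universe u v w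

/-- A twisted (unital, discrete) C⋆-dynamical system `(A, G, α, σ)`. -/
structure TwistedSystem (A : Type u) (G : Type v) [CStarAlgebra A] [Group G] where
  α : G → (A ≃⋆ₐ[ℂ] A)
  σ : G → G → unitary A
  α_comp : ∀ g h a, α g (α h a) = (σ g h : A) * α (g * h) a * star (σ g h : A)
  cocycle : ∀ g h k,
    (σ g h : A) * (σ (g * h) k : A) = α g (σ h k : A) * (σ g (h * k) : A)
  σ_one_right : ∀ g, σ g 1 = 1
  σ_one_left : ∀ g, σ 1 g = 1

namespace TwistedSystem

variable {A : Type u} {G : Type v} [CStarAlgebra A] [Group G] (S : TwistedSystem A G)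

lemma σ_star_mul (g h : G) : star (S.σ g h : A) * (S.σ g h : A) = 1 :=
  Unitary.coe_star_mul_self _

lemma σ_mul_star (g h : G) : (S.σ g h : A) * star (S.σ g h : A) = 1 :=
  Unitary.coe_mul_star_self _

lemma α_comp' (g h : G) (a : A) :
    S.α g (S.α h a) * (S.σ g h : A) = (S.σ g h : A) * S.α (g * h) a := by
  rw [S.α_comp, mul_assoc, S.σ_star_mul, mul_one]

lemma α_one (a : A) : S.α 1 a = a := by
  apply (S.α 1).injective
  simpa [S.σ_one_left] using S.α_comp 1 1 a

lemma α_map_one (g : G) : S.α g 1 = 1 := map_one (S.α g)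

/-- The space `C_c(Σ)` of finitely supported functions from `G` to `A`; it carries the twisted
convolution product and involution. -/
def Cc (_S : TwistedSystem A G) : Type (max u v) := G →₀ A

namespace Cc

variable {S}

instance : AddCommGroup S.Cc := inferInstanceAs (AddCommGroup (G →₀ A))
instance : Module ℂ S.Cc := inferInstanceAs (Module ℂ (G →₀ A))
instance : FunLike S.Cc G A := inferInstanceAs (FunLike (G →₀ A) G A)

variable (S) in
/-- The element `a ⊙ δ_g`. -/
def single (g : G) (a : A) : S.Cc := Finsupp.single g a

variable (S) in
/-- `a ↦ a ⊙ δ_g` as a linear map. -/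
def lsingle (g : G) : A →ₗ[ℂ] S.Cc := Finsupp.lsingle g

lemma lsingle_apply (g : G) (a : A) : lsingle S g a = single S g a := rfl

lemma single_add (g : G) (a b : A) : single S g (a + b) = single S g a + single S g b :=
  Finsupp.single_add ..

lemma single_smul (g : G) (c : ℂ) (a : A) : single S g (c • a) = c • single S g a :=
  (Finsupp.smul_single c g a).symm

lemma single_zero (g : G) : single S g 0 = 0 := Finsupp.single_zero _

lemma single_apply (g h : G) [Decidable (g = h)] (a : A) :
    single S g a h = if g = h then a else 0 := Finsupp.single_apply

lemma add_apply (f₁ f₂ : S.Cc) (g : G) : (f₁ + f₂) g = f₁ g + f₂ g := rfl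

lemma smul_apply (c : ℂ) (f : S.Cc) (g : G) : (c • f) g = c • f g := rfl

@[elab_as_elim]
lemma induction {p : S.Cc → Prop} (f : S.Cc) (h0 : p 0) (hadd : ∀ f₁ f₂, p f₁ → p f₂ → p (f₁ + f₂))
    (hs : ∀ g a, p (single S g a)) : p f :=
  Finsupp.induction_linear f h0 hadd hs

/-- Additive maps on `C_c(Σ)` from families of additive maps on `A`. -/
def lift {M : Type*} [AddCommMonoid M] (F : G → A →+ M) : S.Cc →+ M :=
  Finsupp.liftAddHom F

lemma lift_single {M : Type*} [AddCommMonoid M] (F : G → A →+ M) (g : G) (a : A) :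
    lift F (single S g a) = F g a := Finsupp.liftAddHom_apply_single F g a

lemma lift_apply {M : Type*} [AddCommMonoid M] (F : G → A →+ M) (f : S.Cc) :
    lift F f = Finsupp.sum (α := G) (M := A) f (fun g a => F g a) := rfl

/-- The product of `a ⊙ δ_g` and `b ⊙ δ_h`, as a biadditive map. -/
def singleMul (g h : G) : A →+ A →+ S.Cc :=
  AddMonoidHom.mk' (fun a => AddMonoidHom.mk'
    (fun b => single S (g * h) (a * S.α g b * (S.σ g h : A)))
    (fun b c => by rw [map_add, mul_add, add_mul, single_add]))
    (fun a a' => by ext b : 1; simp [add_mul, single_add])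

variable (S) in
/-- The twisted convolution product, see `mul_apply`. -/
def mulHom : S.Cc →+ S.Cc →+ S.Cc :=
  lift fun g => AddMonoidHom.flip (lift fun h => (singleMul g h).flip)

instance : Mul S.Cc := ⟨fun f₁ f₂ => mulHom S f₁ f₂⟩
instance : One S.Cc := ⟨single S 1 1⟩

lemma one_def : (1 : S.Cc) = single S 1 1 := rfl
lemma mul_def (f₁ f₂ : S.Cc) : f₁ * f₂ = mulHom S f₁ f₂ := rfl

lemma single_mul_single (g h : G) (a b : A) :
    single S g a * single S h b = single S (g * h) (a * S.α g b * (S.σ g h : A)) := by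
  rw [mul_def, mulHom, lift_single, AddMonoidHom.flip_apply, lift_single]; rfl

instance : NonUnitalNonAssocRing S.Cc :=
  { (inferInstance : AddCommGroup S.Cc), (inferInstance : Mul S.Cc) with
    left_distrib := fun a b c => by simp only [mul_def, map_add]
    right_distrib := fun a b c => by simp only [mul_def, map_add, AddMonoidHom.add_apply]
    zero_mul := fun a => by simp only [mul_def, map_zero, AddMonoidHom.zero_apply]
    mul_zero := fun a => by simp only [mul_def, map_zero] }

/-- The convolution product is given by the usual formula. -/
lemma mul_apply (f₁ f₂ : S.Cc) (h : G) : (f₁ * f₂) h =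
    ∑ᶠ g : G, f₁ g * S.α g (f₂ (g⁻¹ * h)) * (S.σ g (g⁻¹ * h) : A) := by
  classical
  have fin : ∀ f₁ f₂ : S.Cc, (Function.support fun g : G =>
      f₁ g * S.α g (f₂ (g⁻¹ * h)) * (S.σ g (g⁻¹ * h) : A)).Finite := by
    intro f₁ f₂
    refine (Finsupp.hasFiniteSupport (f := (f₁ : G →₀ A))).subset fun g hg => ?_
    rw [Function.mem_support] at hg ⊢
    intro h0
    apply hg
    have : f₁ g = 0 := h0
    rw [this, zero_mul, zero_mul]
  induction f₁ using induction with
  | h0 => rw [zero_mul]; simp [show ∀ g, (0 : S.Cc) g = 0 from fun _ => rfl]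
  | hadd a b ha hb =>
    rw [add_mul, add_apply, ha, hb, ← finsum_add_distrib (fin _ _) (fin _ _)]
    simp [add_apply, add_mul]
  | hs g a =>
    induction f₂ using induction with
    | h0 => rw [mul_zero]; simp [show ∀ g, (0 : S.Cc) g = 0 from fun _ => rfl]
    | hadd a b ha hb =>
      rw [mul_add, add_apply, ha, hb, ← finsum_add_distrib (fin _ _) (fin _ _)]
      simp [add_apply, mul_add, add_mul]
    | hs k b =>
      rw [single_mul_single, single_apply, finsum_eq_single _ g]
      · simp only [single_apply, if_true]
        by_cases hh : g * k = h
        · subst hh; simp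
        · have : ¬ k = g⁻¹ * h := fun e => hh (by rw [e]; group)
          simp [hh, this]
      · intro x hx
        simp [single_apply, hx.symm]

instance : Ring S.Cc :=
  { (inferInstance : NonUnitalNonAssocRing S.Cc), (inferInstance : One S.Cc) with
    one_mul := fun f => by
      induction f using induction with
      | h0 => exact mul_zero _
      | hadd a b ha hb => rw [mul_add, ha, hb]
      | hs g a => rw [one_def, single_mul_single]; simp [S.α_one, S.σ_one_left]
    mul_one := fun f => by
      induction f using induction with
      | h0 => exact zero_mul _
      | hadd a b ha hb => rw [add_mul, ha, hb]
      | hs g a => rw [one_def, single_mul_single]; simp [S.α_map_one, S.σ_one_right]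
    mul_assoc := fun x y z => by
      induction x using induction with
      | h0 => simp only [zero_mul]
      | hadd a b ha hb => simp only [add_mul, ha, hb]
      | hs g a =>
      induction y using induction with
      | h0 => simp only [zero_mul, mul_zero]
      | hadd a b ha hb => simp only [add_mul, mul_add, ha, hb]
      | hs h b =>
      induction z using induction with
      | h0 => simp only [mul_zero]
      | hadd a b ha hb => simp only [mul_add, ha, hb]
      | hs k c =>
        simp only [single_mul_single, mul_assoc g h k]
        congr 1
        simp only [map_mul, mul_assoc]
        rw [← S.cocycle g h k, ← mul_assoc (S.α g (S.α h c)), S.α_comp', mul_assoc] }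

lemma smul_mul (c : ℂ) (x y : S.Cc) : (c • x) * y = c • (x * y) := by
  induction x using induction with
  | h0 => simp only [smul_zero, zero_mul]
  | hadd a b ha hb => simp only [smul_add, add_mul, ha, hb]
  | hs g a =>
  induction y using induction with
  | h0 => simp only [smul_zero, mul_zero]
  | hadd a b ha hb => simp only [smul_add, mul_add, ha, hb]
  | hs h b => simp only [← single_smul, single_mul_single, smul_mul_assoc]

lemma mul_smul' (c : ℂ) (x y : S.Cc) : x * (c • y) = c • (x * y) := by
  induction x using induction with
  | h0 => simp only [smul_zero, zero_mul]
  | hadd a b ha hb => simp only [smul_add, add_mul, ha, hb]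
  | hs g a =>
  induction y using induction with
  | h0 => simp only [smul_zero, mul_zero]
  | hadd a b ha hb => simp only [smul_add, mul_add, ha, hb]
  | hs h b => simp only [← single_smul, single_mul_single, map_smul, smul_mul_assoc, mul_smul_comm]

instance : Algebra ℂ S.Cc := Algebra.ofModule smul_mul mul_smul'

/-- The involution, see `star_apply`. -/
instance : Star S.Cc := ⟨lift fun g => AddMonoidHom.mk'
  (fun a => single S g⁻¹ (star (S.σ g⁻¹ g : A) * star (S.α g⁻¹ a)))
  (fun a b => by rw [map_add, star_add, mul_add, single_add])⟩

lemma star_single (g : G) (a : A) :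
    star (single S g a) = single S g⁻¹ (star (S.σ g⁻¹ g : A) * star (S.α g⁻¹ a)) :=
  lift_single _ _ _

lemma star_add' (x y : S.Cc) : star (x + y) = star x + star y := map_add (lift _) x y

lemma star_zero' : star (0 : S.Cc) = 0 := map_zero (lift _)

/-- The involution is given by the usual formula. -/
lemma star_apply (f : S.Cc) (h : G) :
    star f h = star (S.σ h h⁻¹ : A) * star (S.α h (f h⁻¹)) := by
  classical
  induction f using induction with
  | h0 => rw [star_zero']; simp [show ∀ g, (0 : S.Cc) g = 0 from fun _ => rfl]
  | hadd a b ha hb => rw [star_add', add_apply, ha, hb, add_apply, map_add, star_add, mul_add]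
  | hs g a =>
    rw [star_single, single_apply, single_apply]
    by_cases hh : g = h⁻¹
    · subst hh; simp
    · have : ¬ g⁻¹ = h := fun e => hh (by rw [← e, inv_inv])
      simp [hh, this]

lemma α_σ (g : G) : S.α g (S.σ g⁻¹ g : A) = (S.σ g g⁻¹ : A) := by
  have := S.cocycle g g⁻¹ g
  simpa [S.σ_one_left, S.σ_one_right] using this.symm

lemma star_star_single (g : G) (a : A) : star (star (single S g a)) = single S g a := by
  rw [star_single, star_single]
  simp only [inv_inv, map_mul, map_star, star_mul, star_star, S.α_comp, α_σ]
  congr 1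
  rw [mul_inv_cancel, S.α_one]
  simp only [← mul_assoc, S.σ_star_mul, one_mul]
  rw [mul_assoc, S.σ_star_mul, mul_one]

lemma emb_mul (a b : A) : single S 1 a * single S 1 b = single S 1 (a * b) := by
  rw [single_mul_single]; simp [S.α_one, S.σ_one_left]

lemma emb_mul_single (g : G) (a b : A) :
    single S 1 a * single S g b = single S g (a * b) := by
  rw [single_mul_single]; simp [S.α_one, S.σ_one_left]

lemma delta_mul_emb (g : G) (a : A) :
    single S g 1 * single S 1 a = single S 1 (S.α g a) * single S g 1 := by
  rw [emb_mul_single, single_mul_single]; simp [S.σ_one_right]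

lemma delta_mul_star (g : G) : single S g 1 * star (single S g 1) = 1 := by
  rw [star_single, single_mul_single, one_def]
  simp [map_star, α_σ, S.σ_star_mul]

lemma star_mul_delta (g : G) : star (single S g 1) * single S g 1 = 1 := by
  rw [star_single, single_mul_single, one_def]
  simp [S.σ_star_mul]

lemma delta_mul_delta (g h : G) :
    single S g 1 * single S h 1 = single S 1 (S.σ g h : A) * single S (g * h) 1 := by
  rw [emb_mul_single, single_mul_single]; simp

lemma star_single' (g : G) (a : A) :
    star (single S g a) = star (single S g 1) * single S 1 (star a) := by
  rw [star_single, star_single, single_mul_single]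
  simp [S.σ_one_right, map_star]

lemma star_mul_single (g h : G) (a b : A) :
    star (single S g a * single S h b) = star (single S h b) * star (single S g a) := by
  rw [single_mul_single, star_single' (g * h), star_single' g, star_single' h]
  have h1 : single S 1 (star b) * star (single S g 1)
      = star (single S g 1) * single S 1 (S.α g (star b)) := by
    calc _ = star (single S g 1) * (single S g 1 * single S 1 (star b)) * star (single S g 1) := by
          rw [← mul_assoc, star_mul_delta, one_mul]
      _ = _ := by rw [delta_mul_emb, mul_assoc, mul_assoc, delta_mul_star, mul_one]
  have h2 : star (single S h 1) * star (single S g 1)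
      = star (single S (g * h) 1) * single S 1 (star (S.σ g h : A)) := by
    have e : single S 1 (star (S.σ g h : A)) * (single S g 1 * single S h 1)
        = single S (g * h) 1 := by
      rw [delta_mul_delta, ← mul_assoc, emb_mul, S.σ_star_mul, ← one_def, one_mul]
    calc _ = star (single S (g * h) 1) * (single S 1 (star (S.σ g h : A)) *
            (single S g 1 * single S h 1)) * (star (single S h 1) * star (single S g 1)) := by
          rw [e, star_mul_delta, one_mul]
      _ = _ := by
          have : single S g 1 * single S h 1 * (star (single S h 1) * star (single S g 1)) = 1 := by
            rw [mul_assoc, ← mul_assoc (single S h 1), delta_mul_star, one_mul, delta_mul_star]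
          rw [mul_assoc, mul_assoc (single S 1 _), this, mul_one]
  rw [mul_assoc (star (single S h 1)), ← mul_assoc (single S 1 (star b)), h1,
    mul_assoc (star (single S g 1)), ← mul_assoc (star (single S h 1)), h2]
  simp only [mul_assoc, emb_mul, star_mul, map_star]

instance : StarRing S.Cc where
  star_involutive := fun x => by
    induction x using induction with
    | h0 => simp only [star_zero']
    | hadd a b ha hb => simp only [star_add', ha, hb]
    | hs g a => exact star_star_single g a
  star_mul := fun x y => by
    induction x using induction with
    | h0 => simp only [star_zero', zero_mul, mul_zero]
    | hadd a b ha hb => simp only [add_mul, mul_add, star_add', ha, hb]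
    | hs g a =>
    induction y using induction with
    | h0 => simp only [star_zero', zero_mul, mul_zero]
    | hadd a b ha hb => simp only [add_mul, mul_add, star_add', ha, hb]
    | hs h b => exact star_mul_single g h a b
  star_add := star_add'

instance : StarModule ℂ S.Cc where
  star_smul := fun c x => by
    induction x using induction with
    | h0 => simp only [star_zero', smul_zero]
    | hadd a b ha hb => simp only [star_add', smul_add, ha, hb]
    | hs g a => simp only [← single_smul, star_single, map_smul, star_smul, mul_smul_comm]

end Cc

/-- A covariant homomorphism `(π, u)` of `Σ` into a (unital) C⋆-algebra `C`. -/
structure CovariantHom (S : TwistedSystem A G) (C : Type w) [CStarAlgebra C] where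
  π : A →⋆ₐ[ℂ] C
  u : G → unitary C
  u_mul : ∀ g h, (u g : C) * (u h : C) = π (S.σ g h : A) * (u (g * h) : C)
  covariant : ∀ g a, π (S.α g a) = (u g : C) * π a * star (u g : C)

namespace CovariantHom

variable {S} {C : Type w} [CStarAlgebra C] (c : CovariantHom S C)

lemma u_star_mul (g : G) : star (c.u g : C) * (c.u g : C) = 1 := Unitary.coe_star_mul_self _

lemma u_mul_star (g : G) : (c.u g : C) * star (c.u g : C) = 1 := Unitary.coe_mul_star_self _

lemma u_π (g : G) (a : A) : (c.u g : C) * c.π a = c.π (S.α g a) * (c.u g : C) := by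
  rw [c.covariant, mul_assoc, c.u_star_mul, mul_one]

lemma u_one : (c.u 1 : C) = 1 := by
  have h := c.u_mul 1 1
  rw [S.σ_one_left, mul_one, OneMemClass.coe_one, map_one, one_mul] at h
  calc (c.u 1 : C) = star (c.u 1 : C) * ((c.u 1 : C) * (c.u 1 : C)) := by
        rw [← mul_assoc, c.u_star_mul, one_mul]
    _ = 1 := by rw [h, c.u_star_mul]

/-- The additive map `f ↦ ∑ g, π (f g) u(g)`. -/
def sumHom : S.Cc →+ C :=
  Cc.lift fun g => AddMonoidHom.mk' (fun a => c.π a * (c.u g : C))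
    (fun a b => by rw [map_add, add_mul])

lemma sumHom_single (g : G) (a : A) : c.sumHom (Cc.single S g a) = c.π a * (c.u g : C) :=
  Cc.lift_single _ _ _

lemma sumHom_mul (x y : S.Cc) : c.sumHom (x * y) = c.sumHom x * c.sumHom y := by
  induction x using Cc.induction with
  | h0 => simp only [zero_mul, map_zero]
  | hadd a b ha hb => simp only [add_mul, map_add, ha, hb]
  | hs g a =>
  induction y using Cc.induction with
  | h0 => simp only [mul_zero, map_zero]
  | hadd a b ha hb => simp only [mul_add, map_add, ha, hb]
  | hs h b =>
    rw [Cc.single_mul_single, c.sumHom_single, c.sumHom_single, c.sumHom_single, map_mul, map_mul,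
      mul_assoc, ← c.u_mul, mul_assoc, ← mul_assoc _ (c.u g : C), ← c.u_π]
    simp only [mul_assoc]

lemma sumHom_smul (r : ℂ) (x : S.Cc) : c.sumHom (r • x) = r • c.sumHom x := by
  induction x using Cc.induction with
  | h0 => simp only [smul_zero, map_zero]
  | hadd a b ha hb => simp only [smul_add, map_add, ha, hb]
  | hs g a => rw [← Cc.single_smul, c.sumHom_single, c.sumHom_single, map_smul, smul_mul_assoc]

lemma sumHom_one : c.sumHom 1 = 1 := by
  rw [Cc.one_def, c.sumHom_single, map_one, c.u_one, one_mul]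

lemma sumHom_star (x : S.Cc) : c.sumHom (star x) = star (c.sumHom x) := by
  induction x using Cc.induction with
  | h0 => simp only [star_zero, map_zero]
  | hadd a b ha hb => simp only [star_add, map_add, ha, hb]
  | hs g a =>
    have key : c.π (star (S.σ g⁻¹ g : A)) * (c.u g⁻¹ : C) = star (c.u g : C) := by
      have h := c.u_mul g⁻¹ g
      rw [inv_mul_cancel, c.u_one, mul_one] at h
      calc _ = c.π (star (S.σ g⁻¹ g : A)) * ((c.u g⁻¹ : C) * (c.u g : C)) * star (c.u g : C) := by
            rw [mul_assoc, mul_assoc, c.u_mul_star, mul_one]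
        _ = _ := by rw [h, ← map_mul, S.σ_star_mul, map_one, one_mul]
    rw [Cc.star_single, c.sumHom_single, c.sumHom_single, map_mul, ← map_star (S.α _), mul_assoc,
      ← c.u_π, ← mul_assoc, key, star_mul, map_star]

/-- The integrated form `π × u` on `C_c(Σ)`, given by `(π × u)(f) = ∑ g, π (f g) u(g)`. -/
def integrated : S.Cc →⋆ₐ[ℂ] C where
  toFun := c.sumHom
  map_one' := c.sumHom_one
  map_mul' := c.sumHom_mul
  map_zero' := map_zero _
  map_add' := map_add _
  commutes' := fun r => by
    rw [Algebra.algebraMap_eq_smul_one, c.sumHom_smul, c.sumHom_one,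
      Algebra.algebraMap_eq_smul_one]
  map_star' := c.sumHom_star

lemma integrated_single (g : G) (a : A) :
    c.integrated (Cc.single S g a) = c.π a * (c.u g : C) := c.sumHom_single g a

lemma integrated_apply (f : S.Cc) : c.integrated f =
    Finsupp.sum (α := G) (M := A) f (fun g a => c.π a * (c.u g : C)) := rfl

lemma norm_u_le (g : G) : ‖(c.u g : C)‖ ≤ 1 := by
  have h := CStarRing.norm_star_mul_self (x := (c.u g : C))
  rw [c.u_star_mul] at h
  have h1 := CStarRing.norm_star_mul_self (x := (1 : C))
  rw [star_one, one_mul] at h1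
  by_contra hlt
  push Not at hlt
  have h2 : ‖(1 : C)‖ ≤ 1 := by
    by_contra h3
    push Not at h3
    nlinarith
  nlinarith

lemma norm_integrated_le (f : S.Cc) : ‖c.integrated f‖ ≤
    Finsupp.sum (α := G) (M := A) f (fun _ a => ‖a‖) := by
  rw [integrated_apply]
  refine (norm_sum_le _ _).trans (Finset.sum_le_sum fun g _ => ?_)
  refine (norm_mul_le _ _).trans ?_
  have h1 := NonUnitalStarAlgHom.norm_apply_le c.π (f g)
  have h2 := c.norm_u_le g
  exact (mul_le_mul h1 h2 (norm_nonneg _) (norm_nonneg _)).trans (mul_one _).le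

end CovariantHom

namespace Cc

variable {S}

/-- The set of all values `‖(π × u)(f)‖`, where `(π, u)` runs over the covariant homomorphisms
of `Σ`. (C⋆-algebras in the universe of `C_c(Σ)` suffice: the C⋆-algebra generated by the image of
`π × u` is isomorphic to one in this universe.) -/
def normSet (f : S.Cc) : Set ℝ :=
  {r | ∃ (C : Type (max u v)) (_ : CStarAlgebra C) (c : CovariantHom S C), r = ‖c.integrated f‖}

/-- The full C⋆-norm on `C_c(Σ)`. -/
def fullNorm (f : S.Cc) : ℝ := sSup (normSet f)

lemma bddAbove_normSet (f : S.Cc) : BddAbove (normSet f) := by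
  refine ⟨Finsupp.sum (α := G) (M := A) f (fun _ a => ‖a‖), ?_⟩
  rintro _ ⟨C, _, c, rfl⟩
  exact c.norm_integrated_le f

lemma norm_le_fullNorm {C : Type (max u v)} [CStarAlgebra C] (c : CovariantHom S C) (f : S.Cc) :
    ‖c.integrated f‖ ≤ fullNorm f := le_csSup (bddAbove_normSet f) ⟨C, _, c, rfl⟩

lemma fullNorm_nonneg (f : S.Cc) : 0 ≤ fullNorm f := by
  apply Real.sSup_nonneg
  rintro _ ⟨C, _, c, rfl⟩
  exact norm_nonneg _

lemma fullNorm_le {f : S.Cc} {r : ℝ} (hr : 0 ≤ r)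
    (h : ∀ (C : Type (max u v)) [CStarAlgebra C] (c : CovariantHom S C), ‖c.integrated f‖ ≤ r) :
    fullNorm f ≤ r := by
  refine Real.sSup_le ?_ hr
  rintro _ ⟨C, _, c, rfl⟩
  exact h C c

lemma fullNorm_add (x y : S.Cc) : fullNorm (x + y) ≤ fullNorm x + fullNorm y := by
  refine fullNorm_le (add_nonneg (fullNorm_nonneg _) (fullNorm_nonneg _)) fun C _ c => ?_
  rw [map_add]
  exact (norm_add_le _ _).trans (add_le_add (norm_le_fullNorm c x) (norm_le_fullNorm c y))

lemma fullNorm_mul (x y : S.Cc) : fullNorm (x * y) ≤ fullNorm x * fullNorm y := by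
  refine fullNorm_le (mul_nonneg (fullNorm_nonneg _) (fullNorm_nonneg _)) fun C _ c => ?_
  rw [map_mul]
  exact (norm_mul_le _ _).trans (mul_le_mul (norm_le_fullNorm c x) (norm_le_fullNorm c y)
    (norm_nonneg _) (fullNorm_nonneg _))

lemma fullNorm_smul_le (r : ℂ) (x : S.Cc) : fullNorm (r • x) ≤ ‖r‖ * fullNorm x := by
  refine fullNorm_le (mul_nonneg (norm_nonneg _) (fullNorm_nonneg _)) fun C _ c => ?_
  rw [map_smul, norm_smul]
  exact mul_le_mul_of_nonneg_left (norm_le_fullNorm c x) (norm_nonneg _)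

lemma fullNorm_neg (x : S.Cc) : fullNorm (-x) = fullNorm x := by
  simp only [fullNorm, normSet, map_neg, norm_neg]

lemma fullNorm_zero : fullNorm (0 : S.Cc) = 0 :=
  le_antisymm (fullNorm_le le_rfl fun C _ c => by rw [map_zero, norm_zero]) (fullNorm_nonneg _)

lemma fullNorm_star (x : S.Cc) : fullNorm (star x) = fullNorm x := by
  simp only [fullNorm, normSet, map_star, norm_star]

lemma fullNorm_star_mul_self (x : S.Cc) : fullNorm x * fullNorm x ≤ fullNorm (star x * x) := by
  have h : fullNorm x ≤ √(fullNorm (star x * x)) := by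
    refine fullNorm_le (Real.sqrt_nonneg _) fun C _ c => Real.le_sqrt_of_sq_le ?_
    have := norm_le_fullNorm c (star x * x)
    rwa [map_mul, map_star, CStarRing.norm_star_mul_self, ← sq] at this
  calc _ ≤ √(fullNorm (star x * x)) * √(fullNorm (star x * x)) :=
        mul_self_le_mul_self (fullNorm_nonneg _) h
    _ = _ := Real.mul_self_sqrt (fullNorm_nonneg _)

/-- `C_c(Σ)` with the full norm. -/
instance : SeminormedRing S.Cc :=
  { (inferInstance : Ring S.Cc), AddGroupSeminorm.toSeminormedAddCommGroup
      { toFun := (fullNorm : S.Cc → ℝ)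
        map_zero' := fullNorm_zero
        add_le' := fullNorm_add
        neg' := fullNorm_neg } with
    norm_mul_le := fullNorm_mul }

lemma norm_def (f : S.Cc) : ‖f‖ = fullNorm f := rfl

instance : NormedAlgebra ℂ S.Cc where
  norm_smul_le := fullNorm_smul_le

instance : NormedStarGroup S.Cc := ⟨fun x => (fullNorm_star x).le⟩

end Cc

/-- The full twisted crossed product `C⋆(Σ)`: the completion of `C_c(Σ)` in the full norm. -/
def FullCrossedProduct (S : TwistedSystem A G) : Type (max u v) :=
  UniformSpace.Completion S.Cc

namespace FullCrossedProduct

variable {S}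

open UniformSpace

instance : NormedRing S.FullCrossedProduct := inferInstanceAs (NormedRing (Completion S.Cc))

instance : Algebra ℂ S.FullCrossedProduct := inferInstanceAs (Algebra ℂ (Completion S.Cc))

instance : NormedAlgebra ℂ S.FullCrossedProduct where
  norm_smul_le := (inferInstance : NormedSpace ℂ (Completion S.Cc)).norm_smul_le

instance : CompleteSpace S.FullCrossedProduct := inferInstanceAs (CompleteSpace (Completion S.Cc))

/-- The canonical map `C_c(Σ) → C⋆(Σ)`. -/
def of (f : S.Cc) : S.FullCrossedProduct := (f : Completion S.Cc)

lemma of_add (x y : S.Cc) : of (x + y) = of x + of y := Completion.coe_add x y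
lemma of_mul (x y : S.Cc) : of (x * y) = of x * of y := Completion.coe_mul x y
lemma of_smul (r : ℂ) (x : S.Cc) : of (r • x) = r • of x := Completion.coe_smul r x
lemma of_one : of (1 : S.Cc) = 1 := rfl
lemma of_zero : of (0 : S.Cc) = 0 := rfl
lemma norm_of (x : S.Cc) : ‖of x‖ = Cc.fullNorm x := Completion.norm_coe x

lemma continuous_of : Continuous (of : S.Cc → S.FullCrossedProduct) := Completion.continuous_coe _

lemma denseRange_of : DenseRange (of : S.Cc → S.FullCrossedProduct) := Completion.denseRange_coe

instance : Star S.FullCrossedProduct :=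
  ⟨fun x => Completion.map (star : S.Cc → S.Cc) x⟩

lemma continuous_star' : Continuous (star : S.FullCrossedProduct → S.FullCrossedProduct) :=
  Completion.continuous_map

lemma uniformContinuous_star_Cc : UniformContinuous (star : S.Cc → S.Cc) :=
  AddMonoidHomClass.uniformContinuous_of_bound (starAddEquiv (R := S.Cc)) 1
    (fun x => by simp)

lemma of_star (x : S.Cc) : of (star x) = star (of x) :=
  (Completion.map_coe uniformContinuous_star_Cc x).symm

instance : StarRing S.FullCrossedProduct where
  star_involutive := fun x => by
    refine denseRange_of.induction_on x
      (isClosed_eq (continuous_star'.comp continuous_star') continuous_id) fun x => ?_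
    rw [← of_star, ← of_star, star_star]
  star_mul := fun x y => by
    refine denseRange_of.induction_on₂ (p := fun x y : S.FullCrossedProduct =>
      star (x * y) = star y * star x) (isClosed_eq (continuous_star'.comp continuous_mul)
      ((continuous_star'.comp continuous_snd).mul (continuous_star'.comp continuous_fst)))
      (fun x y => ?_) x y
    rw [← of_mul, ← of_star, ← of_star, ← of_star, ← of_mul, star_mul]
  star_add := fun x y => by
    refine denseRange_of.induction_on₂ (p := fun x y : S.FullCrossedProduct =>
      star (x + y) = star x + star y) (isClosed_eq (continuous_star'.comp continuous_add)
      ((continuous_star'.comp continuous_fst).add (continuous_star'.comp continuous_snd)))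
      (fun x y => ?_) x y
    rw [← of_add, ← of_star, ← of_star, ← of_star, ← of_add, star_add]

instance : StarModule ℂ S.FullCrossedProduct where
  star_smul := fun r x => by
    refine denseRange_of.induction_on x (isClosed_eq (continuous_star'.comp (continuous_const_smul _))
      (continuous_star'.const_smul (star r))) fun x => ?_
    rw [← of_smul, ← of_star, ← of_star, star_smul, of_smul]

instance : CStarRing S.FullCrossedProduct where
  norm_mul_self_le := fun x => by
    refine denseRange_of.induction_on x (isClosed_le (continuous_norm.mul continuous_norm)
      (continuous_norm.comp (continuous_star'.mul continuous_id))) fun x => ?_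
    rw [← of_star, ← of_mul, norm_of, norm_of]
    exact Cc.fullNorm_star_mul_self x

instance : CStarAlgebra S.FullCrossedProduct where

variable (S) in
/-- The canonical homomorphism `C_c(Σ) → C⋆(Σ)`. -/
def ofHom : S.Cc →⋆ₐ[ℂ] S.FullCrossedProduct where
  toFun := of
  map_one' := of_one
  map_mul' := of_mul
  map_zero' := of_zero
  map_add' := of_add
  commutes' := fun r => by
    rw [Algebra.algebraMap_eq_smul_one, of_smul, of_one, Algebra.algebraMap_eq_smul_one]
  map_star' := of_star

variable (S) in
/-- The canonical homomorphism `i_A : A → C⋆(Σ)`, `i_A(a) = a ⊙ δ_e`. -/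
def iA : A →⋆ₐ[ℂ] S.FullCrossedProduct where
  toFun := fun a => of (Cc.single S 1 a)
  map_one' := of_one
  map_mul' := fun a b => by rw [← of_mul, Cc.emb_mul]
  map_zero' := by rw [Cc.single_zero, of_zero]
  map_add' := fun a b => by rw [Cc.single_add, of_add]
  commutes' := fun r => by
    rw [Algebra.algebraMap_eq_smul_one, Cc.single_smul, of_smul, ← Cc.one_def, of_one,
      Algebra.algebraMap_eq_smul_one]
  map_star' := fun a => by rw [← of_star, Cc.star_single]; simp [S.α_one, S.σ_one_left]

variable (S) in
/-- The canonical unitary `i_G(g) = 1 ⊙ δ_g` of `C⋆(Σ)`. -/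
def iG (g : G) : S.FullCrossedProduct := of (Cc.single S g 1)

/-- The extension to `C⋆(Σ)` of the integrated form `π × u` of a covariant homomorphism. -/
def integratedForm {C : Type (max u v)} [CStarAlgebra C] (c : CovariantHom S C) :
    S.FullCrossedProduct →⋆ₐ[ℂ] C :=
  have hc : Continuous c.integrated.toRingHom :=
    AddMonoidHomClass.continuous_of_bound c.integrated.toRingHom 1
      fun x => by rw [one_mul]; exact Cc.norm_le_fullNorm c x
  have h : ∀ x, Completion.extensionHom c.integrated.toRingHom hc (of x) = c.integrated x :=
    Completion.extensionHom_coe _ hc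
  have hcont : Continuous (Completion.extensionHom c.integrated.toRingHom hc) :=
    Completion.continuous_extension
  { (Completion.extensionHom c.integrated.toRingHom hc :
      S.FullCrossedProduct →+* C) with
    commutes' := fun r => by
      have := h (algebraMap ℂ S.Cc r)
      rw [AlgHomClass.commutes] at this
      exact this
    map_star' := fun x => by
      refine denseRange_of.induction_on x (isClosed_eq (hcont.comp continuous_star')
        (continuous_star.comp hcont)) fun x => ?_
      change Completion.extensionHom c.integrated.toRingHom hc _ =
        star (Completion.extensionHom c.integrated.toRingHom hc _)
      rw [← of_star, h, h, map_star] }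

lemma integratedForm_of {C : Type (max u v)} [CStarAlgebra C] (c : CovariantHom S C) (f : S.Cc) :
    integratedForm c (of f) = c.integrated f :=
  Completion.extensionHom_coe c.integrated.toRingHom
    (AddMonoidHomClass.continuous_of_bound c.integrated.toRingHom 1
      fun x => by rw [one_mul]; exact Cc.norm_le_fullNorm c x) f

/-- The covariant homomorphism `(π, u)` given by `π(a) = φ(a ⊙ δ_e)`, `u(g) = φ(1 ⊙ δ_g)` for a
homomorphism `φ` of `C⋆(Σ)`. -/
def disintegration {C : Type w} [CStarAlgebra C] (φ : S.FullCrossedProduct →⋆ₐ[ℂ] C) :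
    CovariantHom S C where
  π := φ.comp (iA S)
  u := fun g => ⟨φ (iG S g), by
    rw [Unitary.mem_iff, ← map_star, ← map_mul, ← map_mul, iG, ← of_star, ← of_mul, ← of_mul,
      Cc.star_mul_delta, Cc.delta_mul_star, of_one, map_one]
    exact ⟨rfl, rfl⟩⟩
  u_mul := fun g h => by
    change φ (of _) * φ (of _) = φ (of _) * φ (of _)
    rw [← map_mul, ← map_mul, ← of_mul, ← of_mul, Cc.delta_mul_delta]
  covariant := fun g a => by
    change φ (of _) = φ (of _) * φ (of _) * star (φ (of _))
    rw [← map_star, ← map_mul, ← map_mul, ← of_star, ← of_mul, ← of_mul, Cc.delta_mul_emb,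
      mul_assoc, Cc.delta_mul_star, mul_one]

/-- Every homomorphism `φ` of `C⋆(Σ)` is of the form `π × u`. -/
lemma disintegration_integrated {C : Type w} [CStarAlgebra C]
    (φ : S.FullCrossedProduct →⋆ₐ[ℂ] C) (f : S.Cc) :
    φ (of f) = (disintegration φ).integrated f := by
  induction f using Cc.induction with
  | h0 => rw [of_zero, map_zero, map_zero]
  | hadd a b ha hb => rw [of_add, map_add, map_add, ha, hb]
  | hs g a =>
    rw [CovariantHom.integrated_single]
    change _ = φ (of _) * φ (of _)
    rw [← map_mul, ← of_mul, Cc.emb_mul_single, mul_one]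

end FullCrossedProduct

end TwistedSystem

/-! ### Hilbert C⋆-modules and their adjointable operators -/

/-- A (right) Hilbert C⋆-module `X` over `A`, the inner product being linear in the second
variable. -/
class HilbertModule (A : Type u) (X : Type w) [CStarAlgebra A] [NormedAddCommGroup X]
    [NormedSpace ℂ X] [Module Aᵐᵒᵖ X] extends Inner A X, CompleteSpace X where
  inner_add_right : ∀ x y z : X, inner x (y + z) = inner x y + inner x z
  inner_smul_right : ∀ (r : ℂ) (x y : X), inner x (r • y) = r • inner x y
  inner_op_smul_right : ∀ (a : A) (x y : X), inner x (MulOpposite.op a • y) = inner x y * a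
  star_inner : ∀ x y : X, star (inner x y) = inner y x
  inner_self_nonneg : ∀ x : X, ∃ c : A, inner x x = star c * c
  norm_sq_eq : ∀ x : X, ‖x‖ ^ 2 = ‖inner x x‖

namespace HilbertModule

section CauchySchwarz

variable {A : Type u} [CStarAlgebra A]

lemma norm_sq_le_of_forall {a b c : A} (ha : ∃ e, a = star e * e)
    (h : ∀ d : A, ∃ e, star d * a * d - star d * b - star b * d + c = star e * e) :
    ‖b‖ ^ 2 ≤ ‖a‖ * ‖c‖ := by
  let _ := CStarAlgebra.spectralOrder A
  let _ := CStarAlgebra.spectralOrderedRing A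
  have hsa : IsSelfAdjoint a := by
    obtain ⟨e, rfl⟩ := ha
    exact IsSelfAdjoint.star_mul_self e
  have key : ∀ ε : ℝ, 0 < ε → ‖b‖ ^ 2 ≤ (‖a‖ + ε) * ‖c‖ := by
    intro ε hε
    have hK : 0 < ‖a‖ + ε := add_pos_of_nonneg_of_pos (norm_nonneg _) hε
    set t : ℝ := (‖a‖ + ε)⁻¹ with ht
    have htpos : 0 < t := inv_pos.mpr hK
    obtain ⟨e, he⟩ := h (t • b)
    have h0 : 0 ≤ star e * e := star_mul_self_nonneg e
    rw [← he] at h0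
    have h1 : star (t • b) * a * (t • b) = (t * t) • (star b * a * b) := by
      simp [smul_smul]
    have h2 : star (t • b) * b + star b * (t • b) = (2 * t) • (star b * b) := by
      simp [two_mul, add_smul]
    have h3 : star b * a * b ≤ ‖a‖ • (star b * b) :=
      CStarAlgebra.star_left_conjugate_le_norm_smul
    have h4 : (t * t) • (star b * a * b) ≤ t • (star b * b) := by
      calc (t * t) • (star b * a * b) ≤ (t * t) • (‖a‖ • (star b * b)) :=
            smul_le_smul_of_nonneg_left h3 (mul_nonneg htpos.le htpos.le)
        _ = (t * t * ‖a‖) • (star b * b) := by rw [smul_smul]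
        _ ≤ t • (star b * b) := by
            apply smul_le_smul_of_nonneg_right _ (star_mul_self_nonneg b)
            have : t * (‖a‖ + ε) = 1 := inv_mul_cancel₀ hK.ne'
            nlinarith
    have h5 : t • (star b * b) ≤ c := by
      have e1 : star (t • b) * a * (t • b) - star (t • b) * b - star b * (t • b) + c
          = ((t * t) • (star b * a * b) - t • (star b * b)) + (c - t • (star b * b)) := by
        rw [sub_sub, h2, h1, two_mul, add_smul]; abel
      rw [e1] at h0
      have h6 : (t * t) • (star b * a * b) - t • (star b * b) ≤ 0 := sub_nonpos.mpr h4
      have : 0 ≤ c - t • (star b * b) := h0.trans (by simpa using h6)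
      exact sub_nonneg.mp this
    have h7 := CStarAlgebra.norm_le_norm_of_nonneg_of_le
      (smul_nonneg htpos.le (star_mul_self_nonneg b)) h5
    rw [norm_smul, CStarRing.norm_star_mul_self, Real.norm_of_nonneg htpos.le, ht,
      inv_mul_le_iff₀ hK] at h7
    rw [sq]; exact h7
  refine le_of_forall_pos_le_add fun δ hδ => ?_
  have hc : 0 < ‖c‖ + 1 := by positivity
  refine (key (δ / (‖c‖ + 1)) (by positivity)).trans ?_
  have : δ / (‖c‖ + 1) * ‖c‖ ≤ δ := by
    rw [div_mul_eq_mul_div, div_le_iff₀ hc]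
    nlinarith
  linarith

lemma sqrt_norm_add_le {a b c : A} (h : ‖b‖ ^ 2 ≤ ‖a‖ * ‖c‖) :
    √‖a + b + star b + c‖ ≤ √‖a‖ + √‖c‖ := by
  have hb : ‖b‖ ≤ √‖a‖ * √‖c‖ := by
    rw [← Real.sqrt_mul (norm_nonneg _)]
    exact Real.le_sqrt_of_sq_le h
  rw [Real.sqrt_le_iff]
  refine ⟨by positivity, ?_⟩
  have h1 : ‖a + b + star b + c‖ ≤ ‖a‖ + ‖b‖ + ‖b‖ + ‖c‖ := by
    refine (norm_add_le _ _).trans (add_le_add_left ((norm_add_le _ _).trans ?_) _)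
    rw [norm_star]
    exact add_le_add_left (norm_add_le _ _) _
  have h2 := Real.sq_sqrt (norm_nonneg a)
  have h3 := Real.sq_sqrt (norm_nonneg c)
  nlinarith

end CauchySchwarz

section Basic

variable {A : Type u} {X : Type w} [CStarAlgebra A] [NormedAddCommGroup X] [NormedSpace ℂ X]
  [Module Aᵐᵒᵖ X] [HilbertModule A X]

lemma inner_add_left (x y z : X) : inner A (x + y) z = inner A x z + inner A y z := by
  rw [← star_inner, inner_add_right, star_add, star_inner, star_inner]

lemma inner_smul_left (r : ℂ) (x y : X) : inner A (r • x) y = star r • inner A x y := by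
  rw [← star_inner, inner_smul_right, star_smul, star_inner]

lemma inner_op_smul_left (a : A) (x y : X) :
    inner A (MulOpposite.op a • x) y = star a * inner A x y := by
  rw [← star_inner, inner_op_smul_right, star_mul, star_inner]

lemma inner_neg_right (x y : X) : inner A x (-y) = -inner A x y := by
  rw [← neg_one_smul ℂ, inner_smul_right, neg_one_smul]

lemma inner_sub_right (x y z : X) : inner A x (y - z) = inner A x y - inner A x z := by
  rw [sub_eq_add_neg, inner_add_right, inner_neg_right, sub_eq_add_neg]

lemma inner_sub_left (x y z : X) : inner A (x - y) z = inner A x z - inner A y z := by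
  rw [← star_inner, inner_sub_right, star_sub, star_inner, star_inner]

lemma norm_inner_le (x y : X) : ‖inner A x y‖ ≤ ‖x‖ * ‖y‖ := by
  have h := norm_sq_le_of_forall (a := inner A x x) (b := inner A x y) (c := inner A y y)
    (inner_self_nonneg x) (fun d => by
      obtain ⟨e, he⟩ := inner_self_nonneg (A := A) (MulOpposite.op d • x - y)
      refine ⟨e, ?_⟩
      rw [← he, inner_sub_left, inner_sub_right, inner_sub_right, inner_op_smul_left,
        inner_op_smul_left, inner_op_smul_right, inner_op_smul_right, star_inner]
      noncomm_ring)
  rw [← norm_sq_eq, ← norm_sq_eq, ← mul_pow] at h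
  exact (sq_le_sq₀ (norm_nonneg _) (by positivity)).mp h

lemma ext_inner {x y : X} (h : ∀ z : X, inner A z x = inner A z y) : x = y := by
  have h1 : inner A (x - y) (x - y) = 0 := by rw [inner_sub_right, h, sub_self]
  have h2 := norm_sq_eq (A := A) (x - y)
  rw [h1, norm_zero, sq_eq_zero_iff, norm_eq_zero] at h2
  exact sub_eq_zero.mp h2

lemma continuous_inner_right (x : X) : Continuous fun y : X => inner A x y :=
  (LinearMap.mkContinuous (𝕜 := ℂ) (𝕜₂ := ℂ) (σ := RingHom.id ℂ)
    { toFun := fun y : X => inner A x y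
      map_add' := inner_add_right x
      map_smul' := fun r y => inner_smul_right r x y } ‖x‖ (fun y => norm_inner_le x y)).continuous

variable (A X) in
/-- The algebra `𝓛(X)` of adjointable operators on a Hilbert C⋆-module `X`, normed by the operator
norm. -/
def adjointable : Subalgebra ℂ (X →L[ℂ] X) where
  carrier := {T | ∃ T' : X →L[ℂ] X, ∀ x y : X, inner A (T x) y = inner A x (T' y)}
  mul_mem' := by
    rintro T R ⟨T', hT⟩ ⟨R', hR⟩
    exact ⟨R' * T', fun x y => by
      rw [mul_apply_eq_comp, mul_apply_eq_comp, hT, hR]⟩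
  add_mem' := by
    rintro T R ⟨T', hT⟩ ⟨R', hR⟩
    exact ⟨T' + R', fun x y => by
      rw [_root_.add_apply, _root_.add_apply, inner_add_left,
        inner_add_right, hT, hR]⟩
  algebraMap_mem' := fun r => ⟨star r • 1, fun x y => by
    rw [Algebra.algebraMap_eq_smul_one]
    simp only [_root_.smul_apply, one_apply_eq_self, inner_smul_left,
      inner_smul_right]⟩

variable (A X) in
/-- The C⋆-algebra `𝓛(X)` of adjointable operators on a Hilbert C⋆-module `X`. -/
abbrev Adjointable : Type w := adjointable A X

namespace Adjointable

instance : CoeFun (Adjointable A X) (fun _ => X → X) := ⟨fun T => (T : X →L[ℂ] X)⟩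

lemma ext' {T R : Adjointable A X} (h : ∀ x, T x = R x) : T = R :=
  Subtype.ext (ContinuousLinearMap.ext h)

/-- The adjoint of an adjointable operator. -/
def adj (T : Adjointable A X) : X →L[ℂ] X := Classical.choose T.2

lemma adj_spec (T : Adjointable A X) (x y : X) : inner A (T x) y = inner A x (adj T y) :=
  Classical.choose_spec T.2 x y

instance : Star (Adjointable A X) :=
  ⟨fun T => ⟨adj T, (T : X →L[ℂ] X), fun x y => by
    rw [← star_inner, ← adj_spec, star_inner]⟩⟩

lemma inner_star_right (T : Adjointable A X) (x y : X) :
    inner A x ((star T) y) = inner A (T x) y := (adj_spec T x y).symm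

lemma star_eq_of {T R : Adjointable A X} (h : ∀ x y : X, inner A (T x) y = inner A x (R y)) :
    star T = R :=
  ext' fun y => ext_inner (A := A) fun x => by rw [inner_star_right, h]

lemma inner_star_left (T : Adjointable A X) (x y : X) :
    inner A ((star T) x) y = inner A x (T y) := by
  rw [← star_inner, inner_star_right, star_inner]

lemma mul_apply (T R : Adjointable A X) (x : X) : (T * R) x = T (R x) := rfl
lemma add_apply (T R : Adjointable A X) (x : X) : (T + R) x = T x + R x := rfl
lemma smul_apply (r : ℂ) (T : Adjointable A X) (x : X) : (r • T) x = r • T x := rfl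
lemma one_apply (x : X) : (1 : Adjointable A X) x = x := rfl

instance : StarRing (Adjointable A X) where
  star_involutive := fun T => star_eq_of fun x y => inner_star_left T x y
  star_mul := fun T R => star_eq_of fun x y => by
    rw [mul_apply, mul_apply, inner_star_right, inner_star_right]
  star_add := fun T R => star_eq_of fun x y => by
    rw [add_apply, add_apply, inner_add_left, inner_add_right, inner_star_right, inner_star_right]

instance : StarModule ℂ (Adjointable A X) where
  star_smul := fun r T => star_eq_of fun x y => by
    rw [smul_apply, smul_apply, inner_smul_left, inner_smul_right, inner_star_right]

lemma norm_sq_le (T : Adjointable A X) : ‖T‖ * ‖T‖ ≤ ‖star T * T‖ := by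
  have h : ‖(T : X →L[ℂ] X)‖ ≤ √‖star T * T‖ := by
    refine ContinuousLinearMap.opNorm_le_bound _ (Real.sqrt_nonneg _) fun x => ?_
    have h1 : ‖T x‖ ^ 2 ≤ ‖star T * T‖ * ‖x‖ ^ 2 := by
      rw [norm_sq_eq (A := A), ← inner_star_right, ← mul_apply]
      refine (norm_inner_le _ _).trans ?_
      have := ContinuousLinearMap.le_opNorm ((star T * T : Adjointable A X) : X →L[ℂ] X) x
      have h2 : ‖((star T * T : Adjointable A X) : X →L[ℂ] X)‖ = ‖star T * T‖ := rfl
      rw [h2] at this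
      nlinarith [norm_nonneg x]
    have h3 := Real.sqrt_le_sqrt h1
    rwa [Real.sqrt_sq (norm_nonneg _), Real.sqrt_mul (show (0 : ℝ) ≤ ‖star T * T‖ from norm_nonneg _),
      Real.sqrt_sq (norm_nonneg _)] at h3
  calc ‖T‖ * ‖T‖ ≤ √‖star T * T‖ * √‖star T * T‖ := mul_self_le_mul_self (norm_nonneg _) h
    _ = _ := Real.mul_self_sqrt (norm_nonneg _)

instance : CStarRing (Adjointable A X) := ⟨norm_sq_le⟩

lemma norm_star_eq (T : Adjointable A X) : ‖star T‖ = ‖T‖ := norm_star T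

instance : CompleteSpace (Adjointable A X) := by
  have : CompleteSpace X := (inferInstance : HilbertModule A X).toCompleteSpace
  refine Metric.complete_of_cauchySeq_tendsto fun T hT => ?_
  have h1 : CauchySeq fun n => (T n : X →L[ℂ] X) := hT.map uniformContinuous_subtype_val
  have h2 : CauchySeq fun n => ((star (T n) : Adjointable A X) : X →L[ℂ] X) := by
    rw [Metric.cauchySeq_iff] at hT ⊢
    intro ε hε
    obtain ⟨N, hN⟩ := hT ε hε
    refine ⟨N, fun m hm n hn => ?_⟩
    have h3 := hN m hm n hn
    rw [dist_eq_norm] at h3 ⊢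
    have h4 := norm_star_eq (T m - T n)
    rw [star_sub] at h4
    exact h4.trans_lt h3
  obtain ⟨R, hR⟩ := cauchySeq_tendsto_of_complete h1
  obtain ⟨R', hR'⟩ := cauchySeq_tendsto_of_complete h2
  have happ : ∀ {F : ℕ → X →L[ℂ] X} {L : X →L[ℂ] X}, Filter.Tendsto F Filter.atTop (nhds L) →
      ∀ x, Filter.Tendsto (fun n => F n x) Filter.atTop (nhds (L x)) := fun hF x =>
    ((ContinuousLinearMap.apply ℂ X x).continuous.tendsto _).comp hF
  have hmem : R ∈ adjointable A X := ⟨R', fun x y => by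
    have e1 : Filter.Tendsto (fun n => inner A y (T n x)) Filter.atTop (nhds (inner A y (R x))) :=
      ((continuous_inner_right y).tendsto _).comp (happ hR x)
    have e2 : Filter.Tendsto (fun n => inner A x ((star (T n) : Adjointable A X) y)) Filter.atTop
        (nhds (inner A x (R' y))) := ((continuous_inner_right x).tendsto _).comp (happ hR' y)
    have e3 : (fun n => inner A x ((star (T n) : Adjointable A X) y)) =
        fun n => star (inner A y (T n x)) := by
      funext n; rw [inner_star_right, star_inner]
    rw [e3] at e2
    rw [← star_inner]
    exact tendsto_nhds_unique ((continuous_star.tendsto _).comp e1) e2⟩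
  exact ⟨⟨R, hmem⟩, tendsto_subtype_rng.mpr hR⟩

instance : CStarAlgebra (Adjointable A X) where

end Adjointable

end Basic
end HilbertModule

/-! ### The Hilbert modules `A^G` and `A^Σ` -/

section L2

variable {A : Type u} {G : Type v} [CStarAlgebra A]

/-- The finite partial sums `∑_{g ∈ F} β_g (ξ(g)⋆ η(g))`. -/
def finInner (β : G → (A ≃⋆ₐ[ℂ] A)) (F : Finset G) (ξ η : G → A) : A :=
  ∑ g ∈ F, β g (star (ξ g) * η g)

variable {β : G → (A ≃⋆ₐ[ℂ] A)}

lemma β_sq_nonneg [PartialOrder A] [StarOrderedRing A] (g : G) (a : A) :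
    0 ≤ β g (star a * a) := by
  rw [map_mul, map_star]; exact star_mul_self_nonneg _

lemma exists_star_mul_self [PartialOrder A] [StarOrderedRing A] {a : A} (h : 0 ≤ a) :
    ∃ e, a = star e * e := CStarAlgebra.nonneg_iff_eq_star_mul_self.mp h

lemma finInner_self_nonneg [PartialOrder A] [StarOrderedRing A] (F : Finset G) (ξ : G → A) :
    0 ≤ finInner β F ξ ξ := Finset.sum_nonneg fun g _ => β_sq_nonneg g (ξ g)

lemma norm_finInner_sq_le (F : Finset G) (ξ η : G → A) :
    ‖finInner β F ξ η‖ ^ 2 ≤ ‖finInner β F ξ ξ‖ * ‖finInner β F η η‖ := by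
  let _ := CStarAlgebra.spectralOrder A
  let _ := CStarAlgebra.spectralOrderedRing A
  refine HilbertModule.norm_sq_le_of_forall
    (exists_star_mul_self (finInner_self_nonneg F ξ)) fun d => ?_
  have h : star d * finInner β F ξ ξ * d - star d * finInner β F ξ η
      - star (finInner β F ξ η) * d + finInner β F η η
      = finInner β F (fun g => ξ g * (β g).symm d - η g) (fun g => ξ g * (β g).symm d - η g) := by
    simp only [finInner, star_sum, Finset.mul_sum, Finset.sum_mul, ← Finset.sum_sub_distrib,
      ← Finset.sum_add_distrib]
    refine Finset.sum_congr rfl fun g _ => ?_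
    simp only [map_mul, map_star, map_sub, star_mul, star_sub, star_star,
      StarAlgEquiv.apply_symm_apply]
    noncomm_ring
  rw [h]
  exact exists_star_mul_self (finInner_self_nonneg F _)

lemma finInner_add_self (F : Finset G) (ξ η : G → A) :
    finInner β F (ξ + η) (ξ + η) =
      finInner β F ξ ξ + finInner β F ξ η + star (finInner β F ξ η) + finInner β F η η := by
  simp only [finInner, star_sum, ← Finset.sum_add_distrib]
  refine Finset.sum_congr rfl fun g _ => ?_
  simp only [Pi.add_apply, map_mul, map_star, map_add, star_mul, star_add, star_star]
  noncomm_ring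

lemma sqrt_finInner_add_le (F : Finset G) (ξ η : G → A) :
    √‖finInner β F (ξ + η) (ξ + η)‖ ≤ √‖finInner β F ξ ξ‖ + √‖finInner β F η η‖ := by
  rw [finInner_add_self]
  exact HilbertModule.sqrt_norm_add_le (norm_finInner_sq_le F ξ η)

lemma summable_inner {ξ η : G → A} (hξ : Summable fun g => β g (star (ξ g) * ξ g))
    (hη : Summable fun g => β g (star (η g) * η g)) :
    Summable fun g => β g (star (ξ g) * η g) := by
  classical
  rw [summable_iff_vanishing_norm] at *
  intro ε hε
  obtain ⟨s, hs⟩ := hξ ε hε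
  obtain ⟨t, ht⟩ := hη ε hε
  refine ⟨s ∪ t, fun F hF => ?_⟩
  rw [Finset.disjoint_union_right] at hF
  have h1 := hs F hF.1
  have h2 := ht F hF.2
  have h3 := norm_finInner_sq_le (β := β) F ξ η
  simp only [finInner] at h3
  refine lt_of_pow_lt_pow_left₀ 2 hε.le (h3.trans_lt ?_)
  rw [sq]
  exact mul_lt_mul'' h1 h2 (norm_nonneg _) (norm_nonneg _)

lemma norm_finInner_mul_le {ξ w : G → A} {K : ℝ} (hw : ∀ g, ‖w g‖ ≤ K) (F : Finset G) :
    ‖finInner β F (fun g => w g * ξ g) (fun g => w g * ξ g)‖ ≤ (K ^ 2 + 1) * ‖finInner β F ξ ξ‖ := by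
  let _ := CStarAlgebra.spectralOrder A
  let _ := CStarAlgebra.spectralOrderedRing A
  have hK : (0 : ℝ) < K ^ 2 + 1 := by positivity
  have h2 : finInner β F (fun g => w g * ξ g) (fun g => w g * ξ g) ≤
      (K ^ 2 + 1) • finInner β F ξ ξ := by
    rw [finInner, finInner, Finset.smul_sum]
    refine Finset.sum_le_sum fun g _ => ?_
    have e1 : β g (star (w g * ξ g) * (w g * ξ g)) =
        star (β g (ξ g)) * (β g (star (w g) * w g)) * β g (ξ g) := by
      simp only [map_mul, map_star, star_mul]; noncomm_ring
    have hsa : IsSelfAdjoint (β g (star (w g) * w g)) := by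
      rw [map_mul, map_star]; exact IsSelfAdjoint.star_mul_self _
    have e2 : ‖β g (star (w g) * w g)‖ ≤ K ^ 2 + 1 := by
      have := NonUnitalStarAlgHom.norm_apply_le (β g) (star (w g) * w g)
      rw [CStarRing.norm_star_mul_self] at this
      nlinarith [hw g, norm_nonneg (w g)]
    have e3 : β g (star (ξ g) * ξ g) = star (β g (ξ g)) * β g (ξ g) := by
      rw [map_mul, map_star]
    rw [e1, e3]
    exact (CStarAlgebra.star_left_conjugate_le_norm_smul).trans
      (smul_le_smul_of_nonneg_right e2 (star_mul_self_nonneg _))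
  have h3 := CStarAlgebra.norm_le_norm_of_nonneg_of_le (finInner_self_nonneg F _) h2
  rwa [norm_smul, Real.norm_of_nonneg hK.le] at h3

/-- If `‖w g‖ ≤ K` for all `g`, left multiplication by `w` preserves square summability. -/
lemma summable_mul_left {ξ w : G → A} {K : ℝ} (hw : ∀ g, ‖w g‖ ≤ K)
    (hξ : Summable fun g => β g (star (ξ g) * ξ g)) :
    Summable fun g => β g (star (w g * ξ g) * (w g * ξ g)) := by
  rw [summable_iff_vanishing_norm] at *
  intro ε hε
  have hK : (0 : ℝ) < K ^ 2 + 1 := by positivity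
  obtain ⟨s, hs⟩ := hξ (ε / (K ^ 2 + 1)) (by positivity)
  refine ⟨s, fun F hF => ?_⟩
  have h1 := hs F hF
  rw [lt_div_iff₀' hK] at h1
  exact (norm_finInner_mul_le hw F).trans_lt h1

/-- The space of all `ξ : G → A` such that `∑ g, β_g (ξ(g)⋆ ξ(g))` is norm-convergent in `A`. -/
def l2Submodule (β : G → (A ≃⋆ₐ[ℂ] A)) : Submodule ℂ (G → A) where
  carrier := {ξ | Summable fun g => β g (star (ξ g) * ξ g)}
  zero_mem' := by simp [summable_zero]
  add_mem' := by
    intro ξ η hξ hη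
    have h := ((hξ.add (summable_inner hξ hη)).add (summable_inner hη hξ)).add hη
    refine h.congr fun g => ?_
    simp only [Pi.add_apply, map_mul, map_star, map_add, star_add]
    noncomm_ring
  smul_mem' := by
    intro r ξ hξ
    refine (hξ.const_smul (star r * r)).congr fun g => ?_
    simp only [Pi.smul_apply, star_smul, smul_mul_assoc, mul_smul_comm, map_smul, smul_smul]
    rw [mul_comm]

/-- The Hilbert `A`-module of all `ξ : G → A` such that `∑ g, β_g (ξ(g)⋆ ξ(g))` is norm-convergent,
with inner product `∑ g, β_g (ξ(g)⋆ η(g))` and right action `(ξ a)(g) = ξ(g) β_g⁻¹(a)`, for a given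
family `β` of automorphisms of `A`. -/
def L2 (β : G → (A ≃⋆ₐ[ℂ] A)) : Type (max u v) := l2Submodule β

namespace L2

instance : AddCommGroup (L2 β) := inferInstanceAs (AddCommGroup (l2Submodule β))
instance : Module ℂ (L2 β) := inferInstanceAs (Module ℂ (l2Submodule β))
instance : FunLike (L2 β) G A := ⟨Subtype.val, Subtype.val_injective⟩

/-- The element of the module given by a square summable function. -/
def mk (ξ : G → A) (h : Summable fun g => β g (star (ξ g) * ξ g)) : L2 β := ⟨ξ, h⟩

lemma mk_apply (ξ : G → A) (h : Summable fun g => β g (star (ξ g) * ξ g)) (g : G) :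
    mk ξ h g = ξ g := rfl

@[ext]
lemma ext {ξ η : L2 β} (h : ∀ g, ξ g = η g) : ξ = η := DFunLike.ext _ _ h

lemma summable_self (ξ : L2 β) : Summable fun g => β g (star (ξ g) * ξ g) := ξ.2
lemma summable (ξ η : L2 β) : Summable fun g => β g (star (ξ g) * η g) := summable_inner ξ.2 η.2

lemma add_apply (ξ η : L2 β) (g : G) : (ξ + η) g = ξ g + η g := rfl
lemma sub_apply (ξ η : L2 β) (g : G) : (ξ - η) g = ξ g - η g := rfl
lemma zero_apply (g : G) : (0 : L2 β) g = 0 := rfl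
lemma smul_apply (r : ℂ) (ξ : L2 β) (g : G) : (r • ξ) g = r • ξ g := rfl
lemma sub_coe (ξ η : L2 β) : ((ξ - η : L2 β) : G → A) = (ξ : G → A) - η := rfl

/-- The right action of `A`. -/
instance : SMul Aᵐᵒᵖ (L2 β) := ⟨fun a ξ => mk (fun g => ξ g * (β g).symm a.unop) (by
  refine ((ξ.summable_self.mul_left (star a.unop)).mul_right a.unop).congr fun g => ?_
  simp only [map_mul, map_star, star_mul, StarAlgEquiv.apply_symm_apply]
  noncomm_ring)⟩

lemma op_smul_apply (a : Aᵐᵒᵖ) (ξ : L2 β) (g : G) :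
    (a • ξ) g = ξ g * (β g).symm a.unop := rfl

instance : Module Aᵐᵒᵖ (L2 β) where
  one_smul := fun ξ => by ext g; simp [op_smul_apply]
  mul_smul := fun a b ξ => by ext g; simp [op_smul_apply, mul_assoc]
  smul_zero := fun a => by ext g; simp [op_smul_apply, zero_apply]
  smul_add := fun a ξ η => by ext g; simp [op_smul_apply, add_apply, add_mul]
  add_smul := fun a b ξ => by ext g; simp [op_smul_apply, add_apply, mul_add]
  zero_smul := fun ξ => by ext g; simp [op_smul_apply, zero_apply]

instance : Inner A (L2 β) := ⟨fun ξ η => ∑' g, β g (star (ξ g) * η g)⟩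

lemma inner_def (ξ η : L2 β) : inner A ξ η = ∑' g, β g (star (ξ g) * η g) := rfl

lemma hasSum_inner (ξ η : L2 β) :
    Filter.Tendsto (fun F => finInner β F ξ η) Filter.atTop (nhds (inner A ξ η)) :=
  (ξ.summable η).hasSum

lemma norm_inner_sq_le (ξ η : L2 β) :
    ‖inner A ξ η‖ ^ 2 ≤ ‖inner A ξ ξ‖ * ‖inner A η η‖ :=
  le_of_tendsto_of_tendsto' ((hasSum_inner ξ η).norm.pow 2)
    ((hasSum_inner ξ ξ).norm.mul (hasSum_inner η η).norm) fun F => norm_finInner_sq_le F ξ η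

instance : Norm (L2 β) := ⟨fun ξ => √‖inner A ξ ξ‖⟩

lemma norm_def (ξ : L2 β) : ‖ξ‖ = √‖inner A ξ ξ‖ := rfl

lemma sqrt_finInner_le (F : Finset G) (ξ : L2 β) : √‖finInner β F ξ ξ‖ ≤ ‖ξ‖ := by
  let _ := CStarAlgebra.spectralOrder A
  let _ := CStarAlgebra.spectralOrderedRing A
  refine Real.sqrt_le_sqrt (CStarAlgebra.norm_le_norm_of_nonneg_of_le (finInner_self_nonneg F _) ?_)
  exact ξ.summable_self.sum_le_tsum F fun g _ => β_sq_nonneg g (ξ g)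

lemma norm_apply_le (ξ : L2 β) (g : G) : ‖ξ g‖ ≤ ‖ξ‖ := by
  have h := sqrt_finInner_le {g} ξ
  have h1 : ‖β g (ξ g)‖ = ‖ξ g‖ := NonUnitalStarAlgHom.norm_map (β g) (β g).injective _
  rwa [finInner, Finset.sum_singleton, map_mul, map_star, CStarRing.norm_star_mul_self,
    Real.sqrt_mul_self (norm_nonneg _), h1] at h

lemma inner_add_right (ξ η ζ : L2 β) : inner A ξ (η + ζ) = inner A ξ η + inner A ξ ζ := by
  rw [inner_def, inner_def, inner_def, ← (ξ.summable η).tsum_add (ξ.summable ζ)]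
  simp only [add_apply, mul_add, map_add]

lemma star_inner (ξ η : L2 β) : star (inner A ξ η) = inner A η ξ := by
  rw [inner_def, inner_def, tsum_star]
  simp only [← map_star, star_mul, star_star]

lemma inner_smul_right (r : ℂ) (ξ η : L2 β) : inner A ξ (r • η) = r • inner A ξ η := by
  rw [inner_def, inner_def, ← (ξ.summable η).tsum_const_smul]
  simp only [smul_apply, mul_smul_comm, map_smul]

lemma inner_op_smul_right (a : A) (ξ η : L2 β) :
    inner A ξ (MulOpposite.op a • η) = inner A ξ η * a := by
  rw [inner_def, inner_def, ← (ξ.summable η).tsum_mul_right]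
  simp only [op_smul_apply, ← mul_assoc, map_mul, MulOpposite.unop_op,
    StarAlgEquiv.apply_symm_apply]

lemma norm_zero_iff (ξ : L2 β) : ‖ξ‖ = 0 ↔ ξ = 0 := by
  constructor
  · intro h
    ext g
    have := norm_apply_le ξ g
    rw [h] at this
    exact norm_le_zero_iff.mp this
  · rintro rfl
    simp [norm_def, inner_def, zero_apply]

lemma core : NormedSpace.Core ℂ (L2 β) where
  norm_nonneg := fun ξ => Real.sqrt_nonneg _
  norm_smul := fun r ξ => by
    have : inner A (r • ξ) (r • ξ) = (star r * r) • inner A ξ ξ := by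
      rw [inner_smul_right, ← star_inner, inner_smul_right, star_smul, star_inner, smul_smul,
        mul_comm]
    rw [norm_def, this, norm_smul, norm_mul, norm_star, Real.sqrt_mul (by positivity),
      Real.sqrt_mul_self (norm_nonneg _), norm_def]
  norm_triangle := fun ξ η => by
    have : inner A (ξ + η) (ξ + η) =
        inner A ξ ξ + inner A ξ η + star (inner A ξ η) + inner A η η := by
      have hl : ∀ ζ : L2 β, inner A (ξ + η) ζ = inner A ξ ζ + inner A η ζ := fun ζ => by
        rw [← star_inner, inner_add_right, star_add, star_inner, star_inner]
      rw [inner_add_right, hl, hl, star_inner]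
      abel
    rw [norm_def, this]
    exact HilbertModule.sqrt_norm_add_le (norm_inner_sq_le ξ η)
  norm_eq_zero_iff := norm_zero_iff

instance : NormedAddCommGroup (L2 β) := NormedAddCommGroup.ofCore core
instance : NormedSpace ℂ (L2 β) := NormedSpace.ofCore core

instance : CompleteSpace (L2 β) := by
  refine Metric.complete_of_cauchySeq_tendsto fun ξ hξ => ?_
  have hpt : ∀ g, CauchySeq fun n => ξ n g := fun g => by
    rw [Metric.cauchySeq_iff] at hξ ⊢
    intro ε hε
    obtain ⟨N, hN⟩ := hξ ε hε
    refine ⟨N, fun m hm n hn => ?_⟩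
    have := hN m hm n hn
    rw [dist_eq_norm] at this ⊢
    exact (norm_apply_le (ξ m - ξ n) g).trans_lt this
  choose η hη using fun g => cauchySeq_tendsto_of_complete (hpt g)
  have hβc : ∀ g, Continuous (β g) := fun g =>
    AddMonoidHomClass.continuous_of_bound (β g) 1 fun a => by
      rw [one_mul]; exact NonUnitalStarAlgHom.norm_apply_le (β g) a
  have hfin : ∀ ε > 0, ∃ N, ∀ n ≥ N, ∀ F : Finset G,
      √‖finInner β F ((ξ n : G → A) - η) ((ξ n : G → A) - η)‖ ≤ ε := by
    intro ε hε
    obtain ⟨N, hN⟩ := Metric.cauchySeq_iff.mp hξ ε hε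
    refine ⟨N, fun n hn F => ?_⟩
    have hlim : Filter.Tendsto (fun m => √‖finInner β F ((ξ n : G → A) - ξ m) ((ξ n : G → A) - ξ m)‖)
        Filter.atTop (nhds (√‖finInner β F ((ξ n : G → A) - η) ((ξ n : G → A) - η)‖)) := by
      refine (Filter.Tendsto.norm ?_).sqrt
      refine tendsto_finsetSum _ fun g _ => ((hβc g).tendsto _).comp ?_
      have h1 : Filter.Tendsto (fun m => ((ξ n : G → A) - ξ m) g) Filter.atTop
          (nhds (((ξ n : G → A) - η) g)) := tendsto_const_nhds.sub (hη g)
      exact h1.star.mul h1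
    refine le_of_tendsto hlim (Filter.eventually_atTop.mpr ⟨N, fun m hm => ?_⟩)
    have h2 := hN n hn m hm
    rw [dist_eq_norm] at h2
    exact (sqrt_finInner_le F (ξ n - ξ m)).trans h2.le
  have hmem : Summable fun g => β g (star (η g) * η g) := by
    rw [summable_iff_vanishing_norm]
    intro ε hε
    have hε' : 0 < √ε / 2 := by positivity
    obtain ⟨N, hN⟩ := hfin (√ε / 2) hε'
    obtain ⟨s, hs⟩ := summable_iff_vanishing_norm.mp (ξ N).summable_self ((√ε / 2) ^ 2)
      (by positivity)
    refine ⟨s, fun F hF => ?_⟩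
    have h1 : √‖finInner β F (ξ N) (ξ N)‖ < √ε / 2 := by
      rw [Real.sqrt_lt' hε']; exact hs F hF
    have h2 := hN N le_rfl F
    have h3 := sqrt_finInner_add_le (β := β) F (ξ N) (-((ξ N : G → A) - η))
    have h4 : finInner β F (-((ξ N : G → A) - η)) (-((ξ N : G → A) - η)) =
        finInner β F ((ξ N : G → A) - η) ((ξ N : G → A) - η) := by
      simp only [finInner, Pi.neg_apply, star_neg, neg_mul_neg]
    have h5 : (ξ N : G → A) + -((ξ N : G → A) - η) = η := by abel
    rw [h4, h5] at h3
    have h6 : √‖finInner β F η η‖ < √ε := by linarith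
    exact (Real.sqrt_lt_sqrt_iff (norm_nonneg _)).mp h6
  refine ⟨mk η hmem, Metric.tendsto_atTop.mpr fun ε hε => ?_⟩
  obtain ⟨N, hN⟩ := hfin (ε / 2) (by positivity)
  refine ⟨N, fun n hn => ?_⟩
  rw [dist_eq_norm]
  refine lt_of_le_of_lt (b := ε / 2) ?_ (by linarith)
  exact le_of_tendsto' (hasSum_inner (ξ n - mk η hmem) (ξ n - mk η hmem)).norm.sqrt
    fun F => hN n hn F

instance : HilbertModule A (L2 β) where
  inner_add_right := inner_add_right
  inner_smul_right := inner_smul_right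
  inner_op_smul_right := inner_op_smul_right
  star_inner := star_inner
  inner_self_nonneg := fun ξ => by
    let _ := CStarAlgebra.spectralOrder A
    let _ := CStarAlgebra.spectralOrderedRing A
    exact exists_star_mul_self (tsum_nonneg fun g => β_sq_nonneg g (ξ g))
  norm_sq_eq := fun ξ => Real.sq_sqrt (norm_nonneg _)

end L2

end L2

namespace HilbertModule

variable {A : Type u} [CStarAlgebra A] {X Y : Type w} [NormedAddCommGroup X] [NormedSpace ℂ X]
  [Module Aᵐᵒᵖ X] [HilbertModule A X] [NormedAddCommGroup Y] [NormedSpace ℂ Y]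
  [Module Aᵐᵒᵖ Y] [HilbertModule A Y]

/-- Conjugation `T ↦ U T U⋆` by a unitary `U : X → Y` between Hilbert `A`-modules. -/
def conj (U : X ≃ₗᵢ[ℂ] Y) (hU : ∀ x y, inner A (U x) (U y) = inner A x y) :
    Adjointable A X →⋆ₐ[ℂ] Adjointable A Y :=
  let f : (X →L[ℂ] X) → (Y →L[ℂ] Y) := fun T =>
    ((U : X ≃L[ℂ] Y) : X →L[ℂ] Y).comp (T.comp ((U.symm : Y ≃L[ℂ] X) : Y →L[ℂ] X))
  have hf : ∀ (T : Adjointable A X) (x y : Y),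
      inner A (f T x) y = inner A x (f (star T : Adjointable A X) y) := fun T x y => by
    change inner A (U (T (U.symm x))) y = inner A x (U ((star T) (U.symm y)))
    rw [← U.apply_symm_apply y, hU, ← U.apply_symm_apply x, hU, U.symm_apply_apply,
      U.symm_apply_apply, Adjointable.inner_star_right]
  { toFun := fun T => ⟨f T, f (star T : Adjointable A X), hf T⟩
    map_one' := Adjointable.ext' fun x => U.apply_symm_apply x
    map_mul' := fun T R => Adjointable.ext' fun x => by
      change U (T (R (U.symm x))) = U (T (U.symm (U (R (U.symm x)))))
      rw [U.symm_apply_apply]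
    map_zero' := Adjointable.ext' fun x => map_zero U
    map_add' := fun T R => Adjointable.ext' fun x => map_add U _ _
    commutes' := fun r => Adjointable.ext' fun x => by
      change U (r • U.symm x) = r • x
      rw [map_smul, U.apply_symm_apply]
    map_star' := fun T => (Adjointable.star_eq_of fun x y => hf T x y).symm }

lemma conj_apply (U : X ≃ₗᵢ[ℂ] Y) (hU : ∀ x y, inner A (U x) (U y) = inner A x y)
    (T : Adjointable A X) (y : Y) : (conj U hU T) y = U (T (U.symm y)) := rfl

end HilbertModule

namespace TwistedSystem

open HilbertModule

variable {A : Type u} {G : Type v} [CStarAlgebra A] [Group G] (S : TwistedSystem A G)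

/-- The Hilbert `A`-module `A^G` of all `ξ : G → A` with `∑ g, ξ(g)⋆ ξ(g)` norm-convergent. -/
abbrev AG (_S : TwistedSystem A G) : Type (max u v) :=
  L2 (fun _ : G => StarAlgEquiv.refl ℂ A)

/-- The Hilbert `A`-module `A^Σ` of all `ξ : G → A` with `∑ g, α_g⁻¹ (ξ(g)⋆ ξ(g))`
norm-convergent. -/
abbrev ASigma : Type (max u v) := L2 (fun g : G => (S.α g).symm)

/-- The operator `(T ξ)(h) = w(h) ξ(p h)` on `A^G` for a permutation `p` of `G` and a bounded
function `w : G → A`. -/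
def weightedShift (p : Equiv.Perm G) (w : G → A) (hw : ∃ K, ∀ h, ‖w h‖ ≤ K) :
    S.AG →L[ℂ] S.AG :=
  have hs : ∀ ξ : S.AG, Summable fun h => (StarAlgEquiv.refl ℂ A)
      (star (w h * ξ (p h)) * (w h * ξ (p h))) := fun ξ =>
    summable_mul_left (β := fun _ : G => StarAlgEquiv.refl ℂ A)
      (ξ := fun h => ξ (p h)) hw.choose_spec
      ((p.summable_iff (f := fun g => star (ξ g) * ξ g)).mpr ξ.summable_self)
  LinearMap.mkContinuous
    { toFun := fun ξ => L2.mk (fun h => w h * ξ (p h)) (hs ξ)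
      map_add' := fun ξ η => L2.ext fun h => mul_add _ _ _
      map_smul' := fun r ξ => L2.ext fun h => mul_smul_comm _ _ _ }
    (√(hw.choose ^ 2 + 1)) (fun ξ => by
      refine le_of_tendsto' (L2.hasSum_inner _ _).norm.sqrt fun F => ?_
      refine (Real.sqrt_le_sqrt (norm_finInner_mul_le (ξ := fun h => ξ (p h))
        hw.choose_spec F)).trans ?_
      rw [Real.sqrt_mul (by positivity)]
      refine mul_le_mul_of_nonneg_left ?_ (Real.sqrt_nonneg _)
      have h := L2.sqrt_finInner_le (F.map p.toEmbedding) ξ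
      rwa [finInner, Finset.sum_map] at h)

lemma weightedShift_apply (p : Equiv.Perm G) (w : G → A) (hw : ∃ K, ∀ h, ‖w h‖ ≤ K)
    (ξ : S.AG) (h : G) : S.weightedShift p w hw ξ h = w h * ξ (p h) := rfl

lemma bounded_star {A : Type u} {G : Type v} [CStarAlgebra A]
    {p : Equiv.Perm G} {w : G → A} (hw : ∃ K, ∀ h, ‖w h‖ ≤ K) :
    ∃ K, ∀ h, ‖star (w (p.symm h))‖ ≤ K :=
  ⟨hw.choose, fun h => by rw [norm_star]; exact hw.choose_spec _⟩

lemma inner_weightedShift (p : Equiv.Perm G) (w : G → A) (hw : ∃ K, ∀ h, ‖w h‖ ≤ K)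
    (ξ η : S.AG) : inner A (S.weightedShift p w hw ξ) η =
      inner A ξ (S.weightedShift p.symm (fun h => star (w (p.symm h))) (bounded_star hw) η) := by
  rw [L2.inner_def, L2.inner_def, ← p.tsum_eq (fun h => (StarAlgEquiv.refl ℂ A) (star (ξ h) *
    (S.weightedShift p.symm (fun h => star (w (p.symm h))) (bounded_star hw) η) h))]
  refine tsum_congr fun h => ?_
  simp only [weightedShift_apply, Equiv.symm_apply_apply, star_mul, mul_assoc]

/-- The weighted shift as an adjointable operator. -/
def shiftOp (p : Equiv.Perm G) (w : G → A) (hw : ∃ K, ∀ h, ‖w h‖ ≤ K) : Adjointable A S.AG :=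
  ⟨S.weightedShift p w hw, S.weightedShift p.symm _ (bounded_star hw), S.inner_weightedShift p w hw⟩

lemma shiftOp_apply (p : Equiv.Perm G) (w : G → A) (hw : ∃ K, ∀ h, ‖w h‖ ≤ K)
    (ξ : S.AG) (h : G) : (S.shiftOp p w hw ξ) h = w h * ξ (p h) := rfl

lemma star_shiftOp (p : Equiv.Perm G) (w : G → A) (hw : ∃ K, ∀ h, ‖w h‖ ≤ K) :
    star (S.shiftOp p w hw) = S.shiftOp p.symm (fun h => star (w (p.symm h))) (bounded_star hw) :=
  Adjointable.star_eq_of fun ξ η => S.inner_weightedShift p w hw ξ η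

lemma α_symm_key (g n : G) (x : A) :
    (S.α (g * n)).symm (S.σ g n : A) * (S.α n).symm x =
      (S.α (g * n)).symm (S.α g x) * (S.α (g * n)).symm (S.σ g n : A) := by
  apply EquivLike.injective (S.α (g * n))
  rw [map_mul, map_mul, StarAlgEquiv.apply_symm_apply, StarAlgEquiv.apply_symm_apply,
    ← S.α_comp', StarAlgEquiv.apply_symm_apply]

/-- The representation `ℓ~` of `A` on `A^G`, `(ℓ~(a) ξ)(h) = α_h⁻¹(a) ξ(h)`. -/
def ellTilde : A →⋆ₐ[ℂ] Adjointable A S.AG where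
  toFun := fun a => S.shiftOp (Equiv.refl G) (fun h => (S.α h).symm a)
    ⟨‖a‖, fun h => NonUnitalStarAlgHom.norm_apply_le (S.α h).symm a⟩
  map_one' := Adjointable.ext' fun ξ => L2.ext fun h => by
    simp [shiftOp_apply]
  map_mul' := fun a b => Adjointable.ext' fun ξ => L2.ext fun h => by
    simp [shiftOp_apply, mul_assoc]
  map_zero' := Adjointable.ext' fun ξ => L2.ext fun h => by
    rw [shiftOp_apply, map_zero, zero_mul]; rfl
  map_add' := fun a b => Adjointable.ext' fun ξ => L2.ext fun h => by
    simp [shiftOp_apply, add_mul, L2.add_apply]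
  commutes' := fun r => Adjointable.ext' fun ξ => L2.ext fun h => by
    rw [shiftOp_apply, Algebra.algebraMap_eq_smul_one, Algebra.algebraMap_eq_smul_one, map_smul,
      map_one, smul_mul_assoc, one_mul]; rfl
  map_star' := fun a => by
    rw [star_shiftOp]
    refine Adjointable.ext' fun ξ => L2.ext fun h => ?_
    rw [shiftOp_apply, shiftOp_apply, map_star]; rfl

lemma ellTilde_apply (a : A) (ξ : S.AG) (h : G) :
    (S.ellTilde a ξ) h = (S.α h).symm a * ξ h := rfl

/-- The operator `λ~(g)` on `A^G`, `(λ~(g) ξ)(h) = α_h⁻¹(σ(g, g⁻¹h)) ξ(g⁻¹h)`. -/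
def lambdaTildeOp (g : G) : Adjointable A S.AG :=
  S.shiftOp (Equiv.mulLeft g⁻¹) (fun h => (S.α h).symm (S.σ g (g⁻¹ * h) : A))
    ⟨‖(1 : A)‖, fun h => by
      refine (NonUnitalStarAlgHom.norm_apply_le (S.α h).symm _).trans ?_
      have h1 := CStarRing.norm_star_mul_self (x := (S.σ g (g⁻¹ * h) : A))
      have h2 := CStarRing.norm_star_mul_self (x := (1 : A))
      rw [S.σ_star_mul, ← sq] at h1
      rw [star_one, one_mul, h1, ← sq] at h2
      nlinarith [norm_nonneg (S.σ g (g⁻¹ * h) : A), norm_nonneg (1 : A)]⟩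

lemma lambdaTildeOp_apply (g : G) (ξ : S.AG) (h : G) :
    (S.lambdaTildeOp g ξ) h = (S.α h).symm (S.σ g (g⁻¹ * h) : A) * ξ (g⁻¹ * h) := rfl

lemma star_lambdaTildeOp_apply (g : G) (ξ : S.AG) (h : G) :
    ((star (S.lambdaTildeOp g)) ξ) h =
      star ((S.α (g * h)).symm (S.σ g h : A)) * ξ (g * h) := by
  rw [lambdaTildeOp, star_shiftOp, shiftOp_apply]
  simp

/-- The unitary `λ~(g)` on `A^G`. -/
def lambdaTilde (g : G) : unitary (Adjointable A S.AG) :=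
  ⟨S.lambdaTildeOp g, by
    rw [Unitary.mem_iff]
    constructor
    · refine Adjointable.ext' fun ξ => L2.ext fun h => ?_
      rw [Adjointable.mul_apply, star_lambdaTildeOp_apply, lambdaTildeOp_apply, inv_mul_cancel_left,
        ← mul_assoc, ← map_star, ← map_mul, S.σ_star_mul, map_one, one_mul, Adjointable.one_apply]
    · refine Adjointable.ext' fun ξ => L2.ext fun h => ?_
      rw [Adjointable.mul_apply, lambdaTildeOp_apply, star_lambdaTildeOp_apply,
        mul_inv_cancel_left, ← mul_assoc, ← map_star, ← map_mul, S.σ_mul_star, map_one, one_mul,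
        Adjointable.one_apply]⟩

lemma lambdaTilde_apply (g : G) (ξ : S.AG) (h : G) :
    ((S.lambdaTilde g : Adjointable A S.AG) ξ) h =
      (S.α h).symm (S.σ g (g⁻¹ * h) : A) * ξ (g⁻¹ * h) := rfl

/-- The regular covariant representation `(ℓ~, λ~)` of `Σ` on `A^G`. -/
def regularCovariant : CovariantHom S (Adjointable A S.AG) where
  π := S.ellTilde
  u := S.lambdaTilde
  u_mul := fun g k => Adjointable.ext' fun ξ => L2.ext fun h => by
    obtain ⟨m, rfl⟩ : ∃ m, h = g * (k * m) := ⟨k⁻¹ * (g⁻¹ * h), by group⟩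
    have e1 : (g * k)⁻¹ * (g * (k * m)) = m := by group
    rw [Adjointable.mul_apply, Adjointable.mul_apply, lambdaTilde_apply, lambdaTilde_apply,
      ellTilde_apply, lambdaTilde_apply, e1, inv_mul_cancel_left, inv_mul_cancel_left,
      ← mul_assoc ((S.α _).symm _), ← mul_assoc ((S.α _).symm _), S.α_symm_key, ← map_mul,
      ← map_mul, S.cocycle]
  covariant := fun g a => by
    have h : S.ellTilde (S.α g a) * (S.lambdaTilde g : Adjointable A S.AG) =
        (S.lambdaTilde g : Adjointable A S.AG) * S.ellTilde a :=
      Adjointable.ext' fun ξ => L2.ext fun h => by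
        rw [Adjointable.mul_apply, Adjointable.mul_apply, ellTilde_apply, lambdaTilde_apply,
          lambdaTilde_apply, ellTilde_apply, ← mul_assoc, ← mul_assoc]
        obtain ⟨m, rfl⟩ : ∃ m, h = g * m := ⟨g⁻¹ * h, by group⟩
        rw [inv_mul_cancel_left, S.α_symm_key]
    rw [← h, mul_assoc, Unitary.mul_star_self_of_mem (S.lambdaTilde g).2, mul_one]

/-- The homomorphism `Λ = ℓ~ × λ~` of `C⋆(Σ)` into `𝓛(A^G)`. -/
def regularRep : S.FullCrossedProduct →⋆ₐ[ℂ] Adjointable A S.AG :=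
  FullCrossedProduct.integratedForm S.regularCovariant

/-- The reduced twisted crossed product `C⋆_r(Σ)`: the C⋆-subalgebra of `𝓛(A^G)` generated by
`Λ(C_c(Σ))`, i.e. the norm closure of the ⋆-subalgebra `Λ(C_c(Σ))`. -/
def ReducedCrossedProduct : StarSubalgebra ℂ (Adjointable A S.AG) :=
  S.regularCovariant.integrated.range.topologicalClosure

/-- The unitary `J : A^G → A^Σ`, `(J ξ)(g) = α_g(ξ(g))`. -/
def J : S.AG ≃ₗᵢ[ℂ] S.ASigma where
  toFun := fun ξ => L2.mk (fun g => S.α g (ξ g)) (ξ.summable_self.congr fun g => by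
    change star (ξ g) * ξ g = (S.α g).symm (star (S.α g (ξ g)) * S.α g (ξ g))
    rw [← map_star (S.α g), ← map_mul, StarAlgEquiv.symm_apply_apply])
  invFun := fun ξ => L2.mk (fun g => (S.α g).symm (ξ g)) (ξ.summable_self.congr fun g => by
    change (S.α g).symm (star (ξ g) * ξ g) = star ((S.α g).symm (ξ g)) * (S.α g).symm (ξ g)
    rw [map_mul, map_star])
  left_inv := fun ξ => L2.ext fun g => StarAlgEquiv.symm_apply_apply _ _
  right_inv := fun ξ => L2.ext fun g => StarAlgEquiv.apply_symm_apply _ _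
  map_add' := fun ξ η => L2.ext fun g => map_add (S.α g) (ξ g) (η g)
  map_smul' := fun r ξ => L2.ext fun g => map_smul (S.α g) r (ξ g)
  norm_map' := fun ξ => by
    rw [L2.norm_def, L2.norm_def, L2.inner_def, L2.inner_def]
    congr 2
    refine tsum_congr fun g => ?_
    change (S.α g).symm (star (S.α g (ξ g)) * S.α g (ξ g)) = star (ξ g) * ξ g
    rw [← map_star, ← map_mul, StarAlgEquiv.symm_apply_apply]

lemma J_apply (ξ : S.AG) (g : G) : (S.J ξ) g = S.α g (ξ g) := rfl
lemma J_symm_apply (ξ : S.ASigma) (g : G) : (S.J.symm ξ) g = (S.α g).symm (ξ g) := rfl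

lemma inner_J (ξ η : S.AG) : inner A (S.J ξ) (S.J η) = inner A ξ η := by
  rw [L2.inner_def, L2.inner_def]
  refine tsum_congr fun g => ?_
  change (S.α g).symm (star (S.α g (ξ g)) * S.α g (η g)) = star (ξ g) * η g
  rw [← map_star, ← map_mul, StarAlgEquiv.symm_apply_apply]

/-- The composition of a covariant homomorphism with a homomorphism of C⋆-algebras. -/
def CovariantHom.map {S : TwistedSystem A G} {C : Type w} {D : Type*} [CStarAlgebra C]
    [CStarAlgebra D] (c : CovariantHom S C) (ψ : C →⋆ₐ[ℂ] D) : CovariantHom S D where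
  π := ψ.comp c.π
  u := fun g => ⟨ψ (c.u g : C), by
    rw [Unitary.mem_iff, ← map_star, ← map_mul, ← map_mul, c.u_star_mul, c.u_mul_star, map_one]
    exact ⟨rfl, rfl⟩⟩
  u_mul := fun g h => by
    change ψ _ * ψ _ = ψ (c.π _) * ψ _
    rw [← map_mul, ← map_mul, c.u_mul]
  covariant := fun g a => by
    change ψ (c.π _) = ψ _ * ψ (c.π _) * star (ψ _)
    rw [← map_star, ← map_mul, ← map_mul, c.covariant]

/-- The covariant representation `(ℓ_Σ, λ_Σ) = (J ℓ~ J⋆, J λ~ J⋆)` of `Σ` on `A^Σ`. -/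
def sigmaCovariant : CovariantHom S (Adjointable A S.ASigma) :=
  S.regularCovariant.map (conj S.J S.inner_J)

lemma sigmaCovariant_π_apply (a : A) (ξ : S.ASigma) (h : G) :
    (S.sigmaCovariant.π a ξ) h = a * ξ h := by
  change S.α h ((S.α h).symm a * (S.α h).symm (ξ h)) = _
  rw [← map_mul, StarAlgEquiv.apply_symm_apply]

lemma sigmaCovariant_u_apply (g : G) (ξ : S.ASigma) (h : G) :
    ((S.sigmaCovariant.u g : Adjointable A S.ASigma) ξ) h =
      S.α g (ξ (g⁻¹ * h)) * (S.σ g (g⁻¹ * h) : A) := by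
  change S.α h ((S.α h).symm (S.σ g (g⁻¹ * h) : A) * (S.α (g⁻¹ * h)).symm (ξ (g⁻¹ * h))) = _
  obtain ⟨m, rfl⟩ : ∃ m, h = g * m := ⟨g⁻¹ * h, by group⟩
  rw [inv_mul_cancel_left, S.α_symm_key, ← map_mul, StarAlgEquiv.apply_symm_apply]

/-- The homomorphism `Λ_Σ = ℓ_Σ × λ_Σ` of `C⋆(Σ)` into `𝓛(A^Σ)`. -/
def sigmaRep : S.FullCrossedProduct →⋆ₐ[ℂ] Adjointable A S.ASigma :=
  FullCrossedProduct.integratedForm S.sigmaCovariant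

end TwistedSystem

/-- Two homomorphisms defined on the same C⋆-algebra are weakly equivalent if they have the same
kernel. -/
def WeaklyEquivalent {D : Type u} {B₁ : Type v} {B₂ : Type w} [CStarAlgebra D] [CStarAlgebra B₁]
    [CStarAlgebra B₂] (φ₁ : D →⋆ₐ[ℂ] B₁) (φ₂ : D →⋆ₐ[ℂ] B₂) : Prop :=
  RingHom.ker φ₁ = RingHom.ker φ₂

/-- `F` is a faithful conditional expectation of `B` onto its ⋆-subalgebra `D`: a linear, positive,
contractive `D`-bimodule projection of `B` onto `D` such that `F(x⋆x) = 0` only for `x = 0`. -/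
structure IsFaithfulConditionalExpectation {B : Type u} [NormedRing B] [StarRing B]
    [NormedAlgebra ℂ B] [StarModule ℂ B] (D : StarSubalgebra ℂ B) (F : B →ₗ[ℂ] B) : Prop where
  mem : ∀ x, F x ∈ D
  apply_of_mem : ∀ d ∈ D, F d = d
  mul_left : ∀ d ∈ D, ∀ x, F (d * x) = d * F x
  mul_right : ∀ d ∈ D, ∀ x, F (x * d) = F x * d
  nonneg : ∀ x, ∃ y, F (star x * x) = star y * y
  norm_le : ∀ x, ‖F x‖ ≤ ‖x‖
  faithful : ∀ x, F (star x * x) = 0 → x = 0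

end

-- Everything rests on the canonical map `E(x) = ⟨δ_e, Λ(x) δ_e⟩` from `C⋆(Σ)` to `A`. It is
-- positive and `A`-bimodular, it is dominated in norm by `Λ`, and it sends `i_A(a) i_G(g)` to `a`
-- if `g = e` and to `0` otherwise. The central fact is `expectation_star_mul_self_eq_zero_iff`:
-- `E(x⋆x) = 0` exactly when `Λ(x) = 0`. Since `E(x⋆x)` is the square of the vector `Λ(x) δ_e`, its
-- vanishing first kills only that vector. But `E` is equivariant under conjugation by the unitaries
-- `i_G(g)` (`expectation_conj_iG`), and these carry `δ_e` to `δ_g`, so `Λ(x)` kills every `δ_g`.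
-- Hence all coordinates of `Λ(x)⋆ξ` vanish, for every `ξ`.
--
-- If `φ` has the kernel of `Λ`, then `E` factors through `φ`, and `F(φ(x)) = π(E(x))` is the
-- required expectation. Its contractivity needs the general fact that containment of kernels gives
-- domination of norms (`StarAlgHom.norm_apply_le_of_ker_le`).
--
-- Conversely, given `F`, the maps `F ∘ φ` and `π ∘ E` are continuous and agree on the products
-- `i_A(a) i_G(g)`, which span a dense subspace, so they agree everywhere. Faithfulness of `F`,
-- injectivity of `π` and the central fact then turn `φ(x) = 0` into `Λ(x) = 0` and back.
--
-- The unitary `J` conjugates `Λ` into `Λ_Σ`, so these two have the same kernel. Finally,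
-- homomorphisms with the same kernel have isomorphic ranges, and the range of `Λ` is all of
-- `C⋆_r(Σ)` because ranges of homomorphisms of C⋆-algebras are closed.

universe u v w

/-! ### Norm control and closed range for homomorphisms of C⋆-algebras. -/

section StarHom

variable {D : Type*} {B₁ : Type*} {B₂ : Type*} [CStarAlgebra D] [CStarAlgebra B₁] [CStarAlgebra B₂]

lemma StarAlgHom.continuous_of_cstarAlgebra (φ : D →⋆ₐ[ℂ] B₁) : Continuous φ :=
  AddMonoidHomClass.continuous_of_bound φ 1 fun a => by
    rw [one_mul]; exact NonUnitalStarAlgHom.norm_apply_le φ a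

/-- A selfadjoint element can be replaced, modulo the kernel of a homomorphism, by one whose norm
is that of its image. -/
lemma StarAlgHom.exists_norm_le_of_isSelfAdjoint (φ : D →⋆ₐ[ℂ] B₁) {x : D}
    (hx : IsSelfAdjoint x) : ∃ y, φ y = φ x ∧ ‖y‖ ≤ ‖φ x‖ := by
  set r : ℝ := ‖φ x‖ with hr
  have hr0 : 0 ≤ r := norm_nonneg _
  -- Truncation to `[-r, r]`. The spectrum of `φ x` lies in this interval, so `φ (f x) = f (φ x) = φ
  -- x`, while `|f| ≤ r` bounds the norm of `f x`.
  let f : ℝ → ℝ := fun t => max (-r) (min r t)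
  have hf : Continuous f := by fun_prop
  have hφx : IsSelfAdjoint (φ x) := hx.map φ
  have hφ : Continuous φ := φ.continuous_of_cstarAlgebra
  refine ⟨cfc f x, ?_, norm_cfc_le hr0 fun t _ => ?_⟩
  · rw [StarAlgHom.map_cfc φ f x hf.continuousOn hφ hx hφx]
    conv_rhs => rw [← cfc_id' ℝ (φ x)]
    refine cfc_congr fun t ht => ?_
    have h := spectrum.norm_le_norm_mul_of_mem ht
    -- The zero algebra is allowed, and there the unit has norm `0`.
    have h1 : ‖(1 : B₁)‖ ≤ 1 := by
      rcases subsingleton_or_nontrivial B₁ with _ | _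
      · simp [Subsingleton.elim (1 : B₁) 0]
      · rw [CStarRing.norm_one]
    have h2 : |t| ≤ r := by
      rw [← Real.norm_eq_abs]
      exact h.trans (mul_le_of_le_one_right (norm_nonneg _) h1)
    rw [abs_le] at h2
    simp only [f]
    rw [min_eq_right h2.2, max_eq_right h2.1]
  · rw [Real.norm_eq_abs, abs_le]
    exact ⟨le_max_left _ _, max_le (by linarith) (min_le_left _ _)⟩

/-- If the kernel of `φ` is contained in that of `ψ`, then `φ` dominates `ψ` in norm. -/
lemma StarAlgHom.norm_apply_le_of_ker_le (φ : D →⋆ₐ[ℂ] B₁) (ψ : D →⋆ₐ[ℂ] B₂)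
    (h : ∀ x, φ x = 0 → ψ x = 0) (x : D) : ‖ψ x‖ ≤ ‖φ x‖ := by
  -- As `y` and `x⋆x` agree under `φ`, they agree under `ψ`, so `‖ψ x‖² = ‖ψ y‖ ≤ ‖y‖ ≤ ‖φ x‖²` by
  -- the C⋆-identity. This replaces a passage to the quotient by the kernel.
  obtain ⟨y, hy, hn⟩ := φ.exists_norm_le_of_isSelfAdjoint (IsSelfAdjoint.star_mul_self x)
  have h1 : ψ y = ψ (star x * x) := by
    rw [← sub_eq_zero, ← map_sub]
    exact h _ (by rw [map_sub, hy, sub_self])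
  have h2 := (NonUnitalStarAlgHom.norm_apply_le ψ y).trans hn
  rw [h1, map_mul, map_mul, map_star, map_star, CStarRing.norm_star_mul_self,
    CStarRing.norm_star_mul_self] at h2
  exact (mul_self_le_mul_self_iff (norm_nonneg _) (norm_nonneg _)).mpr h2

/-- Real and imaginary parts are lifted separately, which costs the factor `2`. Any fixed constant
is enough for the range to be closed. -/
lemma StarAlgHom.exists_norm_le (φ : D →⋆ₐ[ℂ] B₁) (x : D) :
    ∃ y, φ y = φ x ∧ ‖y‖ ≤ 2 * ‖φ x‖ := by
  obtain ⟨a, ha, han⟩ := φ.exists_norm_le_of_isSelfAdjoint (realPart x).2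
  obtain ⟨b, hb, hbn⟩ := φ.exists_norm_le_of_isSelfAdjoint (imaginaryPart x).2
  refine ⟨a + Complex.I • b, ?_, ?_⟩
  · rw [map_add, map_smul, ha, hb, ← map_smul, ← map_add, realPart_add_I_smul_imaginaryPart]
  · rw [map_realPart] at han
    rw [map_imaginaryPart] at hbn
    have h1 : ‖(realPart (φ x) : B₁)‖ ≤ ‖φ x‖ := realPart.norm_le (φ x)
    have h2 : ‖(imaginaryPart (φ x) : B₁)‖ ≤ ‖φ x‖ := imaginaryPart.norm_le (φ x)
    refine (norm_add_le _ _).trans ?_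
    rw [norm_smul, Complex.norm_I, one_mul]
    linarith

/-- The range of a homomorphism of C⋆-algebras is closed. -/
lemma StarAlgHom.isClosed_range (φ : D →⋆ₐ[ℂ] B₁) : IsClosed (Set.range φ) := by
  let f : NormedAddGroupHom D B₁ := (φ : D →+ B₁).mkNormedAddGroupHom 1 fun a => by
    rw [one_mul]; exact NonUnitalStarAlgHom.norm_apply_le φ a
  have hf : f.SurjectiveOnWith f.range 2 := by
    rintro _ ⟨x, rfl⟩
    exact φ.exists_norm_le x
  -- A point of the closure is the sum of a rapidly convergent series in the range. Preimages chosen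
  -- with norm control form a series that converges in the complete space `D`.
  have h := controlled_closure_of_complete two_pos one_pos hf
  refine isClosed_of_closure_subset fun y hy => ?_
  obtain ⟨x, hx, -⟩ := h y hy
  exact ⟨x, hx⟩

end StarHom

namespace TwistedSystem

open HilbertModule

/-! ### Point masses in the Hilbert modules. -/

section PointMass

variable {A : Type u} {G : Type v} [CStarAlgebra A] {β : G → (A ≃⋆ₐ[ℂ] A)}

open Classical in
/-- The element of the module taking the value `1` at `g` and `0` elsewhere. -/
noncomputable def pointMass (β : G → (A ≃⋆ₐ[ℂ] A)) (g : G) : L2 β :=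
  L2.mk (Pi.single g 1) (summable_of_ne_finset_zero (s := {g}) fun h hh => by
    rw [Finset.mem_singleton] at hh
    simp [Pi.single_eq_of_ne hh])

lemma pointMass_self (g : G) : pointMass β g g = 1 := by
  classical exact Pi.single_eq_same g 1

lemma pointMass_of_ne {g h : G} (hh : h ≠ g) : pointMass β g h = 0 := by
  classical exact Pi.single_eq_of_ne hh 1

lemma inner_pointMass_left (g : G) (ξ : L2 β) : inner A (pointMass β g) ξ = β g (ξ g) := by
  rw [L2.inner_def, tsum_eq_single g fun h hh => by
    rw [pointMass_of_ne hh, star_zero, zero_mul, map_zero], pointMass_self, star_one, one_mul]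

/-- Equality fails when `A` is the zero algebra, hence the inequality. -/
lemma norm_pointMass_le (g : G) : ‖pointMass β g‖ ≤ 1 := by
  rw [L2.norm_def, inner_pointMass_left, pointMass_self, map_one]
  rcases subsingleton_or_nontrivial A with _ | _
  · simp [Subsingleton.elim (1 : A) 0]
  · simp

end PointMass

/-! ### The canonical map `E : C⋆(Σ) → A`. -/

variable {A : Type u} {G : Type v} [CStarAlgebra A] [Group G] (S : TwistedSystem A G)

lemma regularRep_iA (a : A) :
    S.regularRep (FullCrossedProduct.iA S a) = S.ellTilde a := by
  change FullCrossedProduct.integratedForm _ (FullCrossedProduct.of _) = _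
  rw [FullCrossedProduct.integratedForm_of, CovariantHom.integrated_single, CovariantHom.u_one,
    mul_one]
  rfl

lemma regularRep_iG (g : G) :
    S.regularRep (FullCrossedProduct.iG S g) = (S.lambdaTilde g : Adjointable A S.AG) := by
  change FullCrossedProduct.integratedForm _ (FullCrossedProduct.of _) = _
  rw [FullCrossedProduct.integratedForm_of, CovariantHom.integrated_single, map_one, one_mul]
  rfl

/-- The canonical map `E : C⋆(Σ) → A`, `E(x) = ⟨δ_e, Λ(x) δ_e⟩`. -/
noncomputable def expectation : S.FullCrossedProduct →ₗ[ℂ] A where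
  toFun := fun x => (S.regularRep x (pointMass _ 1) : S.AG) 1
  map_add' := fun x y => by rw [map_add]; rfl
  map_smul' := fun r x => by rw [map_smul]; rfl

lemma expectation_apply (x : S.FullCrossedProduct) :
    S.expectation x = (S.regularRep x (pointMass _ 1) : S.AG) 1 := rfl

/-- On `A^G` the automorphisms in the inner product are trivial, so the coordinate at `e` is a
matrix coefficient. In this form adjoints can be moved across. -/
lemma expectation_eq_inner (x : S.FullCrossedProduct) :
    S.expectation x = inner A (pointMass _ 1) (S.regularRep x (pointMass _ 1) : S.AG) := by
  rw [inner_pointMass_left]; rfl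

/-- The bound by `‖Λ(x)‖`, sharper than one by `‖x‖`, is what makes the induced map on the range of
`φ` contractive. -/
lemma norm_expectation_le_regularRep (x : S.FullCrossedProduct) :
    ‖S.expectation x‖ ≤ ‖S.regularRep x‖ := by
  rw [expectation_apply]
  refine (L2.norm_apply_le _ _).trans ?_
  refine (ContinuousLinearMap.le_opNorm (S.regularRep x : S.AG →L[ℂ] S.AG) _).trans ?_
  exact mul_le_of_le_one_right (norm_nonneg _) (norm_pointMass_le _)

lemma continuous_expectation : Continuous S.expectation :=
  AddMonoidHomClass.continuous_of_bound S.expectation 1 fun x => by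
    rw [one_mul]
    exact (S.norm_expectation_le_regularRep x).trans (NonUnitalStarAlgHom.norm_apply_le _ _)

lemma expectation_star (x : S.FullCrossedProduct) :
    S.expectation (star x) = star (S.expectation x) := by
  rw [expectation_eq_inner, expectation_eq_inner, map_star, Adjointable.inner_star_right,
    HilbertModule.star_inner]

/-- This is the source of both positivity and faithfulness: the vanishing of `E(x⋆x)` is that of the
vector `Λ(x) δ_e`. -/
lemma expectation_star_mul_self (x : S.FullCrossedProduct) : S.expectation (star x * x) =
    inner A (S.regularRep x (pointMass _ 1) : S.AG) (S.regularRep x (pointMass _ 1) : S.AG) := by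
  rw [expectation_eq_inner, map_mul, map_star, Adjointable.mul_apply,
    Adjointable.inner_star_right]

lemma expectation_iA_mul (a : A) (x : S.FullCrossedProduct) :
    S.expectation (FullCrossedProduct.iA S a * x) = a * S.expectation x := by
  rw [expectation_apply, map_mul, regularRep_iA, Adjointable.mul_apply, ellTilde_apply,
    ← expectation_apply]
  congr 1
  -- The action formula involves the inverse of `α_e`, which is the identity because `α_e` is.
  rw [← S.α_one ((S.α 1).symm a), StarAlgEquiv.apply_symm_apply]

/-- Taking adjoints reduces right modularity to left modularity, since `E` commutes with the
involution. -/
lemma expectation_mul_iA (a : A) (x : S.FullCrossedProduct) :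
    S.expectation (x * FullCrossedProduct.iA S a) = S.expectation x * a := by
  rw [← star_star (x * _), star_mul, ← map_star, expectation_star, expectation_iA_mul, star_mul,
    star_star, expectation_star, star_star]

/-- No twist survives because `σ(g, e) = 1`. Every point mass is thus in the orbit of `δ_e`, so
information at `δ_e` can be carried to all of `G`. -/
lemma regularRep_iG_pointMass (g : G) :
    S.regularRep (FullCrossedProduct.iG S g) (pointMass _ 1) = (pointMass _ g : S.AG) := by
  refine L2.ext fun h => ?_
  rw [regularRep_iG, lambdaTilde_apply]
  by_cases hh : h = g
  · subst hh
    rw [inv_mul_cancel, pointMass_self, pointMass_self, S.σ_one_right, OneMemClass.coe_one,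
      map_one, one_mul]
  · rw [pointMass_of_ne hh, pointMass_of_ne fun e => hh (inv_mul_eq_one.mp e).symm, mul_zero]

lemma expectation_iG_of_ne {g : G} (hg : g ≠ 1) :
    S.expectation (FullCrossedProduct.iG S g) = 0 := by
  rw [expectation_apply, regularRep_iG_pointMass, pointMass_of_ne hg.symm]

lemma expectation_one : S.expectation 1 = 1 := by
  rw [expectation_apply, map_one S.regularRep, Adjointable.one_apply, pointMass_self]

lemma expectation_iA (a : A) : S.expectation (FullCrossedProduct.iA S a) = a := by
  rw [← mul_one (FullCrossedProduct.iA S a), expectation_iA_mul, expectation_one, mul_one]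

/-! ### Reduction to generators, equivariance and faithfulness of `E`. -/

lemma of_single (g : G) (a : A) : FullCrossedProduct.of (Cc.single S g a) =
    FullCrossedProduct.iA S a * FullCrossedProduct.iG S g := by
  change _ = FullCrossedProduct.of _ * FullCrossedProduct.of _
  rw [← FullCrossedProduct.of_mul, Cc.emb_mul_single, mul_one]

lemma iG_one : FullCrossedProduct.iG S 1 = 1 := rfl

/-- Two continuous additive maps on `C⋆(Σ)` agree if they agree on all `i_A(a) i_G(g)`. -/
lemma FullCrossedProduct.eq_of_eq_iA_mul_iG {M : Type*} [AddCommGroup M] [TopologicalSpace M]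
    [T2Space M] {f₁ f₂ : S.FullCrossedProduct →+ M} (h₁ : Continuous f₁) (h₂ : Continuous f₂)
    (h : ∀ a g, f₁ (iA S a * iG S g) = f₂ (iA S a * iG S g)) (x : S.FullCrossedProduct) :
    f₁ x = f₂ x := by
  refine denseRange_of.induction_on x (isClosed_eq h₁ h₂) fun f => ?_
  induction f using Cc.induction with
  | h0 => rw [of_zero, map_zero, map_zero]
  | hadd a b ha hb => rw [of_add, map_add, map_add, ha, hb]
  | hs g a => rw [of_single, h]

/-- Conjugation moves the support from `k` to `g⁻¹kg`, which is `e` only if `k = e`. This is why `E`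
is equivariant. -/
lemma star_iG_mul_of_mul_iG (g k : G) (a : A) :
    star (FullCrossedProduct.iG S g) * FullCrossedProduct.of (Cc.single S k a) *
      FullCrossedProduct.iG S g =
    FullCrossedProduct.of (Cc.single S (g⁻¹ * (k * g))
      (star (S.σ g⁻¹ g : A) * S.α g⁻¹ (a * (S.σ k g : A)) * (S.σ g⁻¹ (k * g) : A))) := by
  rw [FullCrossedProduct.iG, ← FullCrossedProduct.of_star, ← FullCrossedProduct.of_mul,
    ← FullCrossedProduct.of_mul, mul_assoc, Cc.star_single, Cc.single_mul_single,
    Cc.single_mul_single]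
  simp

/-- The right-hand side is `α_g⁻¹(E(x))`: composing `α_{g⁻¹}` with `α_g` gives `Ad σ(g⁻¹, g)`, so
the inverse of `α_g` is `α_{g⁻¹}` corrected by that unitary. Only the fact that it vanishes with
`E(x)` is needed later. -/
lemma expectation_conj_iG (g : G) (x : S.FullCrossedProduct) :
    S.expectation (star (FullCrossedProduct.iG S g) * x * FullCrossedProduct.iG S g) =
      star (S.σ g⁻¹ g : A) * S.α g⁻¹ (S.expectation x) * (S.σ g⁻¹ g : A) := by
  have hα : Continuous (S.α g⁻¹) := (S.α g⁻¹ : A →⋆ₐ[ℂ] A).continuous_of_cstarAlgebra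
  refine FullCrossedProduct.eq_of_eq_iA_mul_iG S
    (f₁ := (S.expectation : S.FullCrossedProduct →+ A).comp
      ((AddMonoidHom.mulRight (FullCrossedProduct.iG S g)).comp
        (AddMonoidHom.mulLeft (star (FullCrossedProduct.iG S g)))))
    (f₂ := (AddMonoidHom.mulRight (S.σ g⁻¹ g : A)).comp
      ((AddMonoidHom.mulLeft (star (S.σ g⁻¹ g : A))).comp
        ((S.α g⁻¹ : A →+ A).comp (S.expectation : S.FullCrossedProduct →+ A))))
    (S.continuous_expectation.comp
      ((continuous_const.mul continuous_id).mul continuous_const))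
    ((continuous_const.mul (hα.comp S.continuous_expectation)).mul continuous_const)
    (fun a k => ?_) x
  change S.expectation (star (FullCrossedProduct.iG S g) * _ * FullCrossedProduct.iG S g) =
      star (S.σ g⁻¹ g : A) * S.α g⁻¹ (S.expectation _) * (S.σ g⁻¹ g : A)
  rw [← of_single, star_iG_mul_of_mul_iG, of_single, of_single, expectation_iA_mul,
    expectation_iA_mul]
  -- For `k = e` the twists match because `σ(e, g) = 1`; for `k ≠ e` neither element has mass at
  -- `e`.
  by_cases hk : k = 1
  · subst hk
    rw [one_mul, inv_mul_cancel, iG_one, expectation_one, S.σ_one_left, OneMemClass.coe_one,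
      mul_one, mul_one]
  · have h1 : g⁻¹ * (k * g) ≠ 1 := fun e => hk (by simpa [inv_mul_eq_one] using e)
    rw [expectation_iG_of_ne S hk, expectation_iG_of_ne S h1, mul_zero, mul_zero, map_zero,
      mul_zero, zero_mul]

/-- The canonical map `E : C⋆(Σ) → A` is faithful modulo the kernel of `Λ`. -/
lemma expectation_star_mul_self_eq_zero_iff (x : S.FullCrossedProduct) :
    S.expectation (star x * x) = 0 ↔ S.regularRep x = 0 := by
  constructor
  · intro hx
    -- Equivariance gives `E(y⋆y) = 0` for `y = x i_G(g)`, and `Λ(y) δ_e = Λ(x) δ_g`.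
    have h1 : ∀ g, S.regularRep x (pointMass _ g) = (0 : S.AG) := fun g => by
      have h2 := S.expectation_conj_iG g (star x * x)
      rw [hx, map_zero, mul_zero, zero_mul, mul_assoc, mul_assoc, ← mul_assoc (star _), ← star_mul,
        expectation_star_mul_self, map_mul, Adjointable.mul_apply, regularRep_iG_pointMass] at h2
      have h3 := HilbertModule.norm_sq_eq (A := A) (S.regularRep x (pointMass _ g) : S.AG)
      rwa [h2, norm_zero, sq_eq_zero_iff, norm_eq_zero] at h3
    -- For the adjoint no density of the point masses is needed: the coordinate at `g` of `Λ(x)⋆ξ`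
    -- is `⟨Λ(x) δ_g, ξ⟩`.
    rw [← star_eq_zero]
    refine Adjointable.ext' fun ξ => L2.ext fun g => ?_
    have h4 := Adjointable.inner_star_right (S.regularRep x) (pointMass _ g) ξ
    rw [h1, inner_pointMass_left] at h4
    refine Eq.trans h4 ?_
    rw [← HilbertModule.star_inner, ← zero_smul ℂ (0 : S.AG), HilbertModule.inner_smul_right,
      zero_smul, star_zero]
    rfl
  · intro hx
    rw [expectation_apply, map_mul, hx, mul_zero]
    rfl

/-! ### The representation on `A^Σ` and the range of `Λ`. -/

lemma sigmaRep_apply (x : S.FullCrossedProduct) :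
    S.sigmaRep x = conj S.J S.inner_J (S.regularRep x) := by
  refine FullCrossedProduct.eq_of_eq_iA_mul_iG S
    (f₁ := (S.sigmaRep : S.FullCrossedProduct →+ Adjointable A S.ASigma))
    (f₂ := (conj S.J S.inner_J : Adjointable A S.AG →+ Adjointable A S.ASigma).comp
      (S.regularRep : S.FullCrossedProduct →+ Adjointable A S.AG))
    S.sigmaRep.continuous_of_cstarAlgebra
    ((conj S.J S.inner_J).continuous_of_cstarAlgebra.comp
      S.regularRep.continuous_of_cstarAlgebra)
    (fun a g => ?_) x
  change S.sigmaRep _ = conj S.J S.inner_J (S.regularRep _)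
  rw [← of_single, sigmaRep, regularRep, FullCrossedProduct.integratedForm_of,
    FullCrossedProduct.integratedForm_of, CovariantHom.integrated_single,
    CovariantHom.integrated_single, map_mul]
  rfl

lemma sigmaRep_eq_zero_iff (x : S.FullCrossedProduct) :
    S.sigmaRep x = 0 ↔ S.regularRep x = 0 := by
  rw [sigmaRep_apply]
  refine ⟨fun h => Adjointable.ext' fun ξ => S.J.injective ?_, fun h => by rw [h, map_zero]⟩
  -- At the vector `J ξ` the conjugated operator takes the value `J (Λ(x) ξ)`, and `J` is injective.
  have h1 := conj_apply S.J S.inner_J (S.regularRep x) (S.J ξ)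
  rw [h, LinearIsometryEquiv.symm_apply_apply] at h1
  exact h1.symm.trans (map_zero S.J).symm

/-- Density of `C_c(Σ)` gives one inclusion and closedness of the range gives the other. Through
this, an isomorphism with `C⋆_r(Σ)` becomes one between ranges. -/
lemma regularRep_range : S.regularRep.range = S.ReducedCrossedProduct := by
  apply le_antisymm
  · rintro _ ⟨x, rfl⟩
    change S.regularRep x ∈ closure (S.regularCovariant.integrated.range : Set _)
    refine FullCrossedProduct.denseRange_of.induction_on x
      (isClosed_closure.preimage S.regularRep.continuous_of_cstarAlgebra) fun f => subset_closure ⟨f, ?_⟩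
    exact (FullCrossedProduct.integratedForm_of S.regularCovariant f).symm
  · refine StarSubalgebra.topologicalClosure_minimal ?_ S.regularRep.isClosed_range
    rintro _ ⟨f, rfl⟩
    exact ⟨FullCrossedProduct.of f, FullCrossedProduct.integratedForm_of S.regularCovariant f⟩

end TwistedSystem

/-! ### Weak equivalence and isomorphism of ranges. -/

lemma weaklyEquivalent_iff {D : Type u} {B₁ : Type v} {B₂ : Type w} [CStarAlgebra D]
    [CStarAlgebra B₁] [CStarAlgebra B₂] {φ₁ : D →⋆ₐ[ℂ] B₁} {φ₂ : D →⋆ₐ[ℂ] B₂} :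
    WeaklyEquivalent φ₁ φ₂ ↔ ∀ x, φ₁ x = 0 ↔ φ₂ x = 0 :=
  SetLike.ext_iff

/-- Weakly equivalent homomorphisms have isomorphic ranges. -/
lemma WeaklyEquivalent.nonempty_range_equiv {D : Type u} {B₁ : Type v} {B₂ : Type w}
    [CStarAlgebra D] [CStarAlgebra B₁] [CStarAlgebra B₂] {φ₁ : D →⋆ₐ[ℂ] B₁} {φ₂ : D →⋆ₐ[ℂ] B₂}
    (h : WeaklyEquivalent φ₁ φ₂) : Nonempty (φ₁.range ≃⋆ₐ[ℂ] φ₂.range) := by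
  have key : ∀ x y, φ₁ x = φ₁ y ↔ φ₂ x = φ₂ y := fun x y => by
    rw [← sub_eq_zero, ← map_sub, weaklyEquivalent_iff.mp h, map_sub, sub_eq_zero]
  have hs₁ : ∀ b : φ₁.range, ∃ x, φ₁ x = b := fun b => b.2
  have hs₂ : ∀ b : φ₂.range, ∃ x, φ₂ x = b := fun b => b.2
  -- The sections are arbitrary and respect no structure. By `key`, the map `φ₁(x) ↦ φ₂(x)` does not
  -- depend on them, so each algebraic identity is checked in the range of `φ₁` and transported.
  choose s₁ h₁ using hs₁
  choose s₂ h₂ using hs₂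
  exact ⟨{
    toFun := fun b => ⟨φ₂ (s₁ b), s₁ b, rfl⟩
    invFun := fun b => ⟨φ₁ (s₂ b), s₂ b, rfl⟩
    left_inv := fun b => Subtype.ext (((key _ _).mpr (h₂ _)).trans (h₁ b))
    right_inv := fun b => Subtype.ext (((key _ _).mp (h₁ _)).trans (h₂ b))
    map_mul' := fun a b => Subtype.ext (by
      change φ₂ _ = φ₂ _ * φ₂ _
      rw [← map_mul, ← key, map_mul, h₁, h₁, h₁]; rfl)
    map_add' := fun a b => Subtype.ext (by
      change φ₂ _ = φ₂ _ + φ₂ _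
      rw [← map_add, ← key, map_add, h₁, h₁, h₁]; rfl)
    map_star' := fun a => Subtype.ext (by
      change φ₂ _ = star (φ₂ _)
      rw [← map_star, ← key, map_star, h₁, h₁]; rfl)
    map_smul' := fun r a => Subtype.ext (by
      change φ₂ _ = r • φ₂ _
      rw [← map_smul, ← key, map_smul, h₁, h₁]; rfl) }⟩

/-! ### Passage between the kernel condition and the conditional expectation. -/

namespace TwistedSystem

open HilbertModule

variable {A : Type u} {G : Type v} {C : Type w} [CStarAlgebra A] [Group G] [CStarAlgebra C]
  {S : TwistedSystem A G} {φ : S.FullCrossedProduct →⋆ₐ[ℂ] C} {c : S.CovariantHom C}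

/-- The link between `φ` and `(π, u)` is given only on `C_c(Σ)`; on elements supported at `e` it
recovers `π`, because `u(e) = 1`. -/
lemma apply_iA_of_integrated (hφ : ∀ f : S.Cc, φ (FullCrossedProduct.of f) = c.integrated f)
    (a : A) : φ (FullCrossedProduct.iA S a) = c.π a := by
  change φ (FullCrossedProduct.of _) = _
  rw [hφ, CovariantHom.integrated_single, CovariantHom.u_one, mul_one]

lemma apply_iG_of_integrated (hφ : ∀ f : S.Cc, φ (FullCrossedProduct.of f) = c.integrated f)
    (g : G) : φ (FullCrossedProduct.iG S g) = c.u g := by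
  rw [FullCrossedProduct.iG, hφ, CovariantHom.integrated_single, map_one, one_mul]

/-- A homomorphism with the kernel of `Λ` admits a conditional expectation as in the canonical
case. -/
lemma exists_expectation_of_weaklyEquivalent
    (hφ : ∀ f : S.Cc, φ (FullCrossedProduct.of f) = c.integrated f)
    (h : WeaklyEquivalent φ S.regularRep) :
    Function.Injective c.π ∧ ∃ F : φ.range →ₗ[ℂ] φ.range,
      IsFaithfulConditionalExpectation (c.π.range.comap φ.range.subtype) F ∧
        ∀ g : G, g ≠ 1 → ∀ x : φ.range, (x : C) = c.u g → F x = 0 := by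
  rw [weaklyEquivalent_iff] at h
  -- `E(x)` depends only on `Λ(x)`, so `E` descends to the range of `φ`.
  have hE : ∀ x, φ x = 0 → S.expectation x = 0 := fun x hx => by
    rw [expectation_apply, (h x).mp hx]; rfl
  have hker : ∀ x y, φ x = φ y → S.expectation x = S.expectation y := fun x y hxy => by
    rw [← sub_eq_zero, ← map_sub]
    exact hE _ (by rw [map_sub, hxy, sub_self])
  have hs : ∀ b : φ.range, ∃ x, φ x = b := fun b => b.2
  choose s hs using hs
  -- This is `π` with values in the range of `φ`.
  let p : A →ₗ[ℂ] φ.range :=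
    { toFun := fun a => ⟨φ (FullCrossedProduct.iA S a), _, rfl⟩
      map_add' := fun a b => Subtype.ext (by simp)
      map_smul' := fun r a => Subtype.ext (by simp) }
  have hp : ∀ a, ((p a : φ.range) : C) = c.π a := apply_iA_of_integrated hφ
  let F : φ.range →ₗ[ℂ] φ.range :=
    { toFun := fun b => p (S.expectation (s b))
      map_add' := fun a b => by
        rw [← map_add, ← map_add]
        congr 1
        exact hker _ _ (by rw [map_add, hs, hs, hs]; rfl)
      map_smul' := fun r a => by
        rw [RingHom.id_apply, ← map_smul, ← map_smul]
        congr 1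
        exact hker _ _ (by rw [map_smul, hs, hs]; rfl) }
  -- Any preimage computes `F`, so products and adjoints can be lifted in the most convenient way.
  have hF : ∀ (b : φ.range) x, φ x = b → F b = p (S.expectation x) := fun b x hx =>
    congrArg p (hker _ _ ((hs b).trans hx.symm))
  have hpc : ∀ a : A, ∀ d : φ.range, c.π a = (d : C) → d = p a := fun a d hd =>
    Subtype.ext (hd.symm.trans (hp a).symm)
  refine ⟨(injective_iff_map_eq_zero c.π).mpr fun a ha => ?_, F, ⟨?_, ?_, ?_, ?_, ?_, ?_, ?_⟩, ?_⟩
  -- `E ∘ i_A` is the identity and `E` factors through `φ`, so `π = φ ∘ i_A` is injective.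
  · rw [← apply_iA_of_integrated hφ] at ha
    rw [← S.expectation_iA a, hE _ ha]
  · exact fun x => ⟨S.expectation (s x), (hp _).symm⟩
  · rintro d ⟨a, ha⟩
    obtain rfl := hpc a d ha
    rw [hF _ (FullCrossedProduct.iA S a) rfl, expectation_iA]
  · rintro d ⟨a, ha⟩ x
    obtain rfl := hpc a d ha
    rw [hF (p a * x) (FullCrossedProduct.iA S a * s x) (by rw [map_mul, hs]; rfl),
      expectation_iA_mul]
    refine Subtype.ext ?_
    change _ = ((p a : φ.range) : C) * ((p _ : φ.range) : C)
    rw [hp, hp, hp, map_mul]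
  · rintro d ⟨a, ha⟩ x
    obtain rfl := hpc a d ha
    rw [hF (x * p a) (s x * FullCrossedProduct.iA S a) (by rw [map_mul, hs]; rfl),
      expectation_mul_iA]
    refine Subtype.ext ?_
    change _ = ((p _ : φ.range) : C) * ((p a : φ.range) : C)
    rw [hp, hp, hp, map_mul]
  · intro x
    obtain ⟨e, he⟩ := HilbertModule.inner_self_nonneg (A := A)
      (S.regularRep (s x) (pointMass _ 1) : S.AG)
    refine ⟨p e, ?_⟩
    rw [hF (star x * x) (star (s x) * s x) (by rw [map_mul, map_star, hs]; rfl),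
      expectation_star_mul_self, he]
    refine Subtype.ext ?_
    change _ = star ((p e : φ.range) : C) * ((p e : φ.range) : C)
    rw [hp, hp, map_mul, map_star]
  · intro x
    change ‖((p (S.expectation (s x)) : φ.range) : C)‖ ≤ ‖(x : C)‖
    rw [hp, ← hs x]
    -- The chain is `‖π(E(y))‖ ≤ ‖E(y)‖ ≤ ‖Λ(y)‖ ≤ ‖φ(y)‖` for a preimage `y` of `x`; the last step
    -- uses that the kernel of `φ` lies in that of `Λ`.
    exact ((NonUnitalStarAlgHom.norm_apply_le c.π _).trans
      (S.norm_expectation_le_regularRep _)).trans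
        (φ.norm_apply_le_of_ker_le S.regularRep (fun y => (h y).mp) (s x))
  · intro x hx
    rw [hF (star x * x) (star (s x) * s x) (by rw [map_mul, map_star, hs]; rfl)] at hx
    refine Subtype.ext ((hs x).symm.trans ((h _).mpr
      ((S.expectation_star_mul_self_eq_zero_iff _).mp ?_)))
    -- Applying `E` to this element again strips off `π`, leaving `E(y⋆y) = 0` for the preimage `y =
    -- s x`.
    have h2 : φ (FullCrossedProduct.iA S (S.expectation (star (s x) * s x))) = 0 :=
      congrArg Subtype.val hx
    rw [← S.expectation_iA (S.expectation (star (s x) * s x)), hE _ h2]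
  · intro g hg x hx
    rw [hF x (FullCrossedProduct.iG S g) ((apply_iG_of_integrated hφ g).trans hx.symm),
      S.expectation_iG_of_ne hg, map_zero]

/-- If `π` is injective and `π × u` admits a faithful conditional expectation that vanishes on
`u(g)` for `g ≠ e`, then `π × u` has the kernel of `Λ`. -/
lemma weaklyEquivalent_of_expectation
    (hφ : ∀ f : S.Cc, φ (FullCrossedProduct.of f) = c.integrated f)
    (hπ : Function.Injective c.π) {F : φ.range →ₗ[ℂ] φ.range}
    (hF : IsFaithfulConditionalExpectation (c.π.range.comap φ.range.subtype) F)
    (hu : ∀ g : G, g ≠ 1 → ∀ x : φ.range, (x : C) = c.u g → F x = 0) :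
    WeaklyEquivalent φ S.regularRep := by
  have hφc : Continuous φ.rangeRestrict :=
    Continuous.subtype_mk (f := φ) φ.continuous_of_cstarAlgebra _
  have hFc : Continuous F := AddMonoidHomClass.continuous_of_bound F 1 fun a => by
    rw [one_mul]; exact hF.norm_le a
  -- Again `π` with values in the range of `φ`, now as a homomorphism, so that it is continuous and
  -- its values can be pulled out of `F`.
  let q : A →⋆ₐ[ℂ] φ.range := φ.rangeRestrict.comp (FullCrossedProduct.iA S)
  have hq : ∀ a, ((q a : φ.range) : C) = c.π a := apply_iA_of_integrated hφ
  have hmem : ∀ a, q a ∈ c.π.range.comap φ.range.subtype := fun a => ⟨a, (hq a).symm⟩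
  have hqc : Continuous q :=
    hφc.comp (FullCrossedProduct.iA S).continuous_of_cstarAlgebra
  -- Bimodularity, `F(1) = 1` and the vanishing on `u(g)` leave no freedom: `F` must be induced by
  -- `E`.
  have key : ∀ x, F (φ.rangeRestrict x) = q (S.expectation x) := fun x => by
    refine FullCrossedProduct.eq_of_eq_iA_mul_iG S
      (f₁ := (F : φ.range →+ φ.range).comp (φ.rangeRestrict : S.FullCrossedProduct →+ φ.range))
      (f₂ := (q : A →+ φ.range).comp (S.expectation : S.FullCrossedProduct →+ A))
      (hFc.comp hφc) (hqc.comp S.continuous_expectation) (fun a g => ?_) x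
    change F (φ.rangeRestrict (FullCrossedProduct.iA S a * FullCrossedProduct.iG S g)) =
      q (S.expectation (FullCrossedProduct.iA S a * FullCrossedProduct.iG S g))
    have h1 : φ.rangeRestrict (FullCrossedProduct.iA S a * FullCrossedProduct.iG S g) =
        q a * φ.rangeRestrict (FullCrossedProduct.iG S g) := map_mul _ _ _
    rw [h1, hF.mul_left _ (hmem a), expectation_iA_mul]
    by_cases hg : g = 1
    · subst hg
      rw [iG_one, map_one, expectation_one, mul_one, hF.apply_of_mem _ (one_mem _), mul_one]
    · rw [hu g hg _ (apply_iG_of_integrated hφ g), S.expectation_iG_of_ne hg, mul_zero, mul_zero,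
        map_zero]
  rw [weaklyEquivalent_iff]
  intro x
  have e1 : φ x = 0 ↔ φ.rangeRestrict x = 0 :=
    ⟨fun h => Subtype.ext h, fun h => congrArg Subtype.val h⟩
  have e2 : φ.rangeRestrict x = 0 ↔ F (star (φ.rangeRestrict x) * φ.rangeRestrict x) = 0 :=
    ⟨fun h => by rw [h, mul_zero, map_zero], hF.faithful _⟩
  have e3 : ∀ a, q a = 0 ↔ a = 0 := fun a =>
    ⟨fun h => hπ (by rw [← hq, h, map_zero]; rfl), fun h => by rw [h, map_zero]⟩
  -- `φ(x) = 0` iff `F(φ(x⋆x)) = 0` iff `π(E(x⋆x)) = 0` iff `E(x⋆x) = 0` iff `Λ(x) = 0`.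
  rw [e1, e2, ← map_star, ← map_mul, key, e3, expectation_star_mul_self_eq_zero_iff]

end TwistedSystem

theorem proposition3p1 {A G C : Type*} [CStarAlgebra A] [Group G] [CStarAlgebra C]
    (S : TwistedSystem A G) (φ : S.FullCrossedProduct →⋆ₐ[ℂ] C) (c : S.CovariantHom C)
    (hφ : ∀ f : S.Cc, φ (TwistedSystem.FullCrossedProduct.of f) = c.integrated f) :
    List.TFAE
      [WeaklyEquivalent φ S.sigmaRep,
       WeaklyEquivalent φ S.regularRep,
       Function.Injective c.π ∧ ∃ F : φ.range →ₗ[ℂ] φ.range,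
        IsFaithfulConditionalExpectation (c.π.range.comap φ.range.subtype) F ∧
          ∀ g : G, g ≠ 1 → ∀ x : φ.range, (x : C) = c.u g → F x = 0] ∧
    ((Function.Injective c.π ∧ ∃ F : φ.range →ₗ[ℂ] φ.range,
        IsFaithfulConditionalExpectation (c.π.range.comap φ.range.subtype) F ∧
          ∀ g : G, g ≠ 1 → ∀ x : φ.range, (x : C) = c.u g → F x = 0) →
      Nonempty (φ.range ≃⋆ₐ[ℂ] S.ReducedCrossedProduct)) := by
  constructor
  · tfae_have 1 ↔ 2 := by
      simp only [weaklyEquivalent_iff, S.sigmaRep_eq_zero_iff]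
    tfae_have 2 → 3 := TwistedSystem.exists_expectation_of_weaklyEquivalent hφ
    tfae_have 3 → 2 := fun ⟨hπ, F, hF, hu⟩ =>
      TwistedSystem.weaklyEquivalent_of_expectation hφ hπ hF hu
    tfae_finish
  · rintro ⟨hπ, F, hF, hu⟩
    rw [← S.regularRep_range]
    exact (TwistedSystem.weaklyEquivalent_of_expectation hφ hπ hF hu).nonempty_range_equiv
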